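/- Let $\Gamma_1,\Gamma_2$ be nontrivial finitely generated groups with identities $e_1,e_2$, and let $\mu_i$ be a probability measure on $\Gamma_i$ whose random walk is irreducible, i.e. every element of $\Gamma_i$ is a finite product of elements of $\mathrm{supp}(\mu_i)$. Let $G_i(z)=\sum_{n\ge 0}\mu_i^{(n)}(e_i)z^n$ be the Green function ($\mu_i^{(n)}$ is the $n$-fold convolution power), $\mathbf r_i$ its radius of convergence and $\theta_i=\mathbf r_iG_i(\mathbf r_i)\in(0,\infty]$. Let $\Phi_i$ be the function on $[0,\theta_i)$ with $G_i(z)=\Phi_i(zG_i(z))$ for $0\le z<\mathbf r_i$, and put $\Psi_i(t)=\Phi_i(t)-t\Phi_i'(t)$ for $0\le t<\theta_i$ and, if $\theta_i<\infty$, $\Psi_i(\theta_i)=\lim_{t\to\theta_i-}\Psi_i(t)$. For $\alpha_1\in(0,1)$ let $\bar\theta=\bar\theta(\alpha_1)=\min\{\theta_1/\alpha_1,\ \theta_2/(1-\alpha_1)\}$. Assume $\bar\theta<\infty$ (equivalently, $\theta_1<\infty$ or $\theta_2<\infty$; this does not depend on $\alpha_1$). Fix $\mu_1,\mu_2$. Then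 the function $$\Upsilon:(0,1)\to\mathbb R,\qquad \Upsilon(\alpha_1)=\Psi_1(\alpha_1\bar\theta)+\Psi_2((1-\alpha_1)\bar\theta)-1,$$ is continuous, strictly decreasing on $\bigl(0,\frac{\theta_1}{\theta_1+\theta_2}\bigr]\cap(0,1)$ and strictly increasing on $\bigl[\frac{\theta_1}{\theta_1+\theta_2},1\bigr)\cap(0,1)$, where $\frac{c}{c+\infty}:=0$ and $\frac{\infty}{\infty+c}:=1$ for $c\in(0,\infty)$. Moreover $\Upsilon(\alpha_1)=\Psi(\bar\theta)$ for every $\alpha_1\in(0,1)$, in the following sense. Let $G$ be the Green function at the identity of the random walk on the free product $\Gamma_1*\Gamma_2$ with step distribution $\alpha_1\mu_1+(1-\alpha_1)\mu_2$ (each $\mu_i$ being regarded as a measure on $\Gamma_1*\Gamma_2$ through $\Gamma_i\subset\Gamma_1*\Gamma_2$), and $\mathbf r$ its radius of convergence. Then $zG(z)<\bar\theta$ for $0\le z<\mathbf r$, there is a (necessarily unique) analytic function $\Phi$ on $[0,\bar\theta)$ with $G(z)=\Phi(zG(z))$ for $0\le z<\mathbf r$, and with $\Psi(t)=\Phi(t)-t\Phi'(t)$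 one has $\Psi(\bar\theta):=\lim_{t\to\bar\theta-}\Psi(t)=\Upsilon(\alpha_1)$. -/

import Mathlib

open Set Filter Topology
open scoped ENNReal

noncomputable section

namespace FreeProductWalk

/-- The `n`-fold convolution power of a mass function `f` on a group: the law after `n` steps, started
at the identity, of the walk whose transition probabilities are `p (y, x) = f (y⁻¹ * x)`. -/
def convPow {Γ : Type*} [Group Γ] (f : Γ → ℝ≥0∞) : ℕ → Γ → ℝ≥0∞
  | 0 => fun x => open scoped Classical in if x = 1 then 1 else 0
  | n + 1 => fun x => ∑' y, convPow f n y * f (y⁻¹ * x)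

/-- The Green function `G(z) = ∑ f^(n)(e) zⁿ` at a real argument. -/
def green {Γ : Type*} [Group Γ] (f : Γ → ℝ≥0∞) (z : ℝ) : ℝ :=
  ∑' n : ℕ, (convPow f n 1).toReal * z ^ n

/-- The radius of convergence `r` of the Green function. -/
def radius {Γ : Type*} [Group Γ] (f : Γ → ℝ≥0∞) : ℝ≥0∞ :=
  (FormalMultilinearSeries.ofScalars ℝ fun n : ℕ => (convPow f n 1).toReal).radius

/-- `θ = r G(r)`, a value in `[0, ∞]`. -/
def theta {Γ : Type*} [Group Γ] (f : Γ → ℝ≥0∞) : ℝ≥0∞ :=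
  radius f * ∑' n : ℕ, convPow f n 1 * radius f ^ n

/-- The function `Φ` on `[0, θ)` with `G(z) = Φ(z G(z))` for `0 ≤ z < r`: one has `Φ(t) = G(z)` for the
`z ∈ [0, r)` that solves `z G(z) = t`. Only its values on `[0, θ)` are meaningful. -/
def phi {Γ : Type*} [Group Γ] (f : Γ → ℝ≥0∞) (t : ℝ) : ℝ :=
  green f (Function.invFunOn (fun z => z * green f z) {z | 0 ≤ z ∧ ENNReal.ofReal z < radius f} t)

/-- `Ψ(t) = Φ(t) - t Φ'(t)` for `0 ≤ t < θ`, and its left limit at `θ` for `t = θ < ∞`. -/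
def psi {Γ : Type*} [Group Γ] (f : Γ → ℝ≥0∞) (t : ℝ) : ℝ :=
  if ENNReal.ofReal t < theta f then phi f t - t * deriv (phi f) t
  else limUnder (𝓝[<] (theta f).toReal) fun s => phi f s - s * deriv (phi f) s

/-- The walk given by `f` on `Γ` is irreducible: the support of `f` generates `Γ` as a monoid,
so that every element is reached from the identity. -/
def IsIrreducibleWalk {Γ : Type*} [Group Γ] (f : Γ → ℝ≥0∞) : Prop :=
  Submonoid.closure (Function.support f) = ⊤

section TwoFactors

variable {Γ₁ Γ₂ : Type*} [Group Γ₁] [Group Γ₂]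

/-- The measure `α μ₁ + (1 - α) μ₂` on the free product, each `μᵢ` being lifted along the
embedding of its factor. -/
def freeStep (μ₁ : PMF Γ₁) (μ₂ : PMF Γ₂) (α : ℝ) : Monoid.Coprod Γ₁ Γ₂ → ℝ≥0∞ := fun x =>
  ENNReal.ofReal α * (μ₁.map Monoid.Coprod.inl) x
    + ENNReal.ofReal (1 - α) * (μ₂.map Monoid.Coprod.inr) x

/-- `θ̄ = min {θ₁ / α, θ₂ / (1 - α)}`. -/
def thetaBar (μ₁ : PMF Γ₁) (μ₂ : PMF Γ₂) (α : ℝ) : ℝ≥0∞ :=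
  min (theta μ₁ / ENNReal.ofReal α) (theta μ₂ / ENNReal.ofReal (1 - α))

/-- `Υ(α) = Ψ₁(α θ̄) + Ψ₂((1 - α) θ̄) - 1`, where `θ̄` depends on `α`. -/
def upsilon (μ₁ : PMF Γ₁) (μ₂ : PMF Γ₂) (α : ℝ) : ℝ :=
  psi μ₁ (α * (thetaBar μ₁ μ₂ α).toReal) + psi μ₂ ((1 - α) * (thetaBar μ₁ μ₂ α).toReal) - 1

/-- `θ₁ / (θ₁ + θ₂)`, with `c / (c + ∞) = 0` and `∞ / (∞ + c) = 1`. -/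
def alphaCrit (μ₁ : PMF Γ₁) (μ₂ : PMF Γ₂) : ℝ :=
  if theta μ₁ = ∞ then 1 else (theta μ₁ / (theta μ₁ + theta μ₂)).toReal

/-- `L = Ψ(θ̄)`, where `Ψ(t) = Φ(t) - t Φ'(t)` and `Φ` is the function of the walk on the free product:
it satisfies `G(z) = Φ(z G(z))` on `[0, r)`, is continued analytically to `[0, θ̄)`, and `Ψ(θ̄)` stands for
the left limit. The identity theorem makes `Φ` unique on `[0, θ̄)`. -/
def IsPsiThetaBar (μ₁ : PMF Γ₁) (μ₂ : PMF Γ₂) (α L : ℝ) : Prop :=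
  ∃ Φ : ℝ → ℝ, AnalyticOn ℝ Φ (Ico 0 (thetaBar μ₁ μ₂ α).toReal) ∧
    (∀ z : ℝ, 0 ≤ z → ENNReal.ofReal z < radius (freeStep μ₁ μ₂ α) →
      z * green (freeStep μ₁ μ₂ α) z < (thetaBar μ₁ μ₂ α).toReal ∧
      green (freeStep μ₁ μ₂ α) z = Φ (z * green (freeStep μ₁ μ₂ α) z)) ∧
    Tendsto (fun t => Φ t - t * deriv Φ t) (𝓝[<] (thetaBar μ₁ μ₂ α).toReal) (𝓝 L)

end TwoFactors

end FreeProductWalk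

end

/-! Everything rests on `1 - 1/G`, the generating function `U(z)` of first returns to the identity.
Its coefficients are nonnegative, and an irreducible walk on a nontrivial group has a first return
of length at least 2, so `U` is strictly convex and `1/G = 1 - U` strictly concave
(`strictConvexOn_return`). The intercept with the vertical axis of the tangent to `1/G` at `z`
therefore strictly increases with `z`. The substitution `t = zG(z)` turns `Φ(t) - tΦ'(t)` into the
reciprocal of this intercept (`phiIntercept_zGreen`). Hence each `Ψᵢ` is positive, strictly
decreasing and continuous, also up to `θᵢ` when that is finite (`strictAntiOn_psi`,
`continuousOn_psi`).

Monotonicity of `Υ` is then elementary. Up to the critical parameter, `(1 - α)θ̄ = θ₂` is constant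
while `αθ̄` increases, so only the `Ψ₁` term moves, and it decreases. Beyond it the factors exchange
roles.

For the free product, the aim is `Φ(t) = Φ₁(αt) + Φ₂((1 - α)t) - 1`. Let `Uᵢ` count first returns
whose first step lies in factor `i`. An excursion that starts with a step in `Γ₂` can re-enter `Γ₁`
only where it left. Hence `G` is, up to the factor `1/(1 - U₂)`, the Green function of `μ₁` at
`αz/(1 - U₂)` (`genFun_factor`), which gives `Φ₁(αzG) = G(1 - U₂)` (`phi_factor`). Adding the
symmetric identity and `G = 1 + (U₁ + U₂)G` gives the formula on the range of `zG(z)`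
(`phi_freeStep`). Its right side is analytic on all of `[0, θ̄)`, and differentiating it yields the
limit `Υ(α)`. -/

noncomputable section

namespace FreeProductWalk

/-! ### Convolution powers and first-return decomposition -/

section Convolution

variable {X : Type*} [Group X]

/-- Convolution of nonnegative functions on a group. -/
def conv (f g : X → ℝ≥0∞) (x : X) : ℝ≥0∞ := ∑' y, f y * g (y⁻¹ * x)

/-- The unit mass at the identity. -/
def unitMass (x : X) : ℝ≥0∞ := open scoped Classical in if x = 1 then 1 else 0

lemma convPow_zero (f : X → ℝ≥0∞) : convPow f 0 = unitMass := rfl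

lemma convPow_succ (f : X → ℝ≥0∞) (n : ℕ) : convPow f (n + 1) = conv (convPow f n) f := rfl

lemma conv_assoc (f g h : X → ℝ≥0∞) : conv (conv f g) h = conv f (conv g h) := by
  funext x
  simp only [conv, ← ENNReal.tsum_mul_right, ← ENNReal.tsum_mul_left]
  rw [ENNReal.tsum_comm]
  refine tsum_congr fun w => ?_
  rw [← (Equiv.mulLeft w).tsum_eq]
  refine tsum_congr fun v => ?_
  simp [mul_assoc]

lemma unitMass_conv (f : X → ℝ≥0∞) : conv unitMass f = f := by
  funext x
  rw [conv, tsum_eq_single 1]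
  · simp [unitMass]
  · intro y hy
    simp [unitMass, hy]

lemma conv_unitMass (f : X → ℝ≥0∞) : conv f unitMass = f := by
  funext x
  rw [conv, tsum_eq_single x]
  · simp [unitMass]
  · intro y hy
    have : y⁻¹ * x ≠ 1 := fun h => hy (inv_mul_eq_one.mp h)
    simp [unitMass, this]

lemma convPow_succ' (f : X → ℝ≥0∞) (n : ℕ) : convPow f (n + 1) = conv f (convPow f n) := by
  induction n with
  | zero => rw [convPow_succ, convPow_zero, unitMass_conv, conv_unitMass]
  | succ n ih => rw [convPow_succ, ih, conv_assoc, ← convPow_succ, ih]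

lemma conv_add_left (f g h : X → ℝ≥0∞) (x : X) :
    conv (fun y => f y + g y) h x = conv f h x + conv g h x := by
  simp only [conv, add_mul, ENNReal.tsum_add]

lemma conv_mono_right (f : X → ℝ≥0∞) {g h : X → ℝ≥0∞} (hgh : ∀ x, g x ≤ h x) (x : X) :
    conv f g x ≤ conv f h x :=
  ENNReal.tsum_le_tsum fun _ => mul_le_mul_right (hgh _) _

lemma conv_sum_left {ι : Type*} (s : Finset ι) (c : ι → ℝ≥0∞) (F : ι → X → ℝ≥0∞)
    (h : X → ℝ≥0∞) (x : X) :
    conv (fun y => ∑ i ∈ s, c i * F i y) h x = ∑ i ∈ s, c i * conv (F i) h x := by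
  simp only [conv, Finset.sum_mul, ← ENNReal.tsum_mul_left, mul_assoc]
  exact Summable.tsum_finsetSum fun _ _ => ENNReal.summable

lemma conv_tsum_right (f : X → ℝ≥0∞) (c : ℕ → ℝ≥0∞) (F : ℕ → X → ℝ≥0∞) (x : X) :
    conv f (fun y => ∑' n, F n y * c n) x = ∑' n, conv f (F n) x * c n := by
  simp only [conv, ← ENNReal.tsum_mul_left, ← ENNReal.tsum_mul_right]
  rw [ENNReal.tsum_comm]
  simp only [mul_assoc]

lemma conv_const_mul_right (f g : X → ℝ≥0∞) (c : ℝ≥0∞) (x : X) :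
    conv f (fun y => c * g y) x = c * conv f g x := by
  simp only [conv, ← ENNReal.tsum_mul_left]
  exact tsum_congr fun y => by ring

lemma tsum_conv (f g : X → ℝ≥0∞) : ∑' x, conv f g x = (∑' x, f x) * ∑' x, g x := by
  simp only [conv]
  rw [ENNReal.tsum_comm, ← ENNReal.tsum_mul_right]
  refine tsum_congr fun y => ?_
  rw [ENNReal.tsum_mul_left, ← (Equiv.mulLeft y).tsum_eq]
  simp

lemma tsum_convPow_le_one {f : X → ℝ≥0∞} (hf : ∑' x, f x ≤ 1) (n : ℕ) :
    ∑' x, convPow f n x ≤ 1 := by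
  induction n with
  | zero =>
    rw [convPow_zero, tsum_eq_single 1]
    · simp [unitMass]
    · intro y hy
      simp [unitMass, hy]
  | succ n ih =>
    rw [convPow_succ, tsum_conv]
    exact mul_le_one' ih hf

lemma convPow_le_one {f : X → ℝ≥0∞} (hf : ∑' x, f x ≤ 1) (n : ℕ) (x : X) : convPow f n x ≤ 1 :=
  (ENNReal.le_tsum x).trans (tsum_convPow_le_one hf n)

/-- The weight of the paths of `n + 1` steps, the first one distributed by `g` and the others by `f`,
that avoid the identity strictly between their two ends. -/
def taboo (f g : X → ℝ≥0∞) : ℕ → X → ℝ≥0∞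
  | 0 => g
  | n + 1 => conv (fun y => open scoped Classical in if y = 1 then 0 else taboo f g n y) f

/-- Decomposition of the walk with first step `g` at its first return to the identity. -/
lemma conv_convPow_eq_sum_taboo (f g : X → ℝ≥0∞) (n : ℕ) (x : X) :
    conv g (convPow f n) x =
      ∑ k ∈ Finset.HasAntidiagonal.antidiagonal n, taboo f g k.1 1 * convPow f k.2 x +
        open scoped Classical in if x = 1 then 0 else taboo f g n x := by
  classical
  induction n generalizing x with
  | zero =>
    rw [convPow_zero, conv_unitMass]
    by_cases hx : x = 1
    · simp [hx, taboo, convPow_zero, unitMass]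
    · simp [hx, taboo, convPow_zero, unitMass]
  | succ n ih =>
    rw [convPow_succ, ← conv_assoc, Finset.Nat.sum_antidiagonal_succ', funext ih, conv_add_left,
      conv_sum_left]
    -- As `convPow f 0` is the unit mass, the part of the new taboo weight at the identity is
    -- exactly the missing antidiagonal summand.
    have hlast : taboo f g (n + 1) x = taboo f g (n + 1) 1 * convPow f 0 x +
        if x = 1 then 0 else taboo f g (n + 1) x := by
      by_cases hx : x = 1
      · simp [hx, convPow_zero, unitMass]
      · simp [hx, convPow_zero, unitMass]
    have e : conv (fun y => if y = 1 then 0 else taboo f g n y) f x = taboo f g (n + 1) x := by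
      simp only [taboo]
    rw [e, add_comm (taboo f g (n + 1) 1 * convPow f 0 x), add_assoc, ← hlast]
    simp only [convPow_succ]

end Convolution

/-! ### Generating functions with values in `[0, ∞]` -/

section GeneratingFunction

/-- The generating function of a nonnegative sequence. -/
def genFun (a : ℕ → ℝ≥0∞) (z : ℝ≥0∞) : ℝ≥0∞ := ∑' n, a n * z ^ n

lemma genFun_eq_zero_add (a : ℕ → ℝ≥0∞) (z : ℝ≥0∞) :
    genFun a z = a 0 + z * genFun (fun n => a (n + 1)) z := by
  rw [genFun, tsum_eq_zero_add' ENNReal.summable, genFun, ← ENNReal.tsum_mul_left]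
  simp only [pow_zero, mul_one]
  congr 1
  exact tsum_congr fun n => by ring

lemma genFun_add (a b : ℕ → ℝ≥0∞) (z : ℝ≥0∞) :
    genFun (fun n => a n + b n) z = genFun a z + genFun b z := by
  simp only [genFun, add_mul, ENNReal.tsum_add]

lemma genFun_mono (a : ℕ → ℝ≥0∞) : Monotone (genFun a) := fun _ _ h =>
  ENNReal.tsum_le_tsum fun _ => by gcongr

lemma genFun_antidiagonal (a b : ℕ → ℝ≥0∞) (z : ℝ≥0∞) :
    genFun (fun n => ∑ k ∈ Finset.HasAntidiagonal.antidiagonal n, a k.1 * b k.2) z = genFun a z * genFun b z := by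
  simp only [genFun, ← ENNReal.tsum_mul_right]
  simp only [← ENNReal.tsum_mul_left]
  rw [← ENNReal.tsum_prod (f := fun i j => a i * z ^ i * (b j * z ^ j)),
    ← Finset.HasAntidiagonal.sigmaAntidiagonalEquivProd.tsum_eq, ENNReal.tsum_sigma']
  refine tsum_congr fun n => ?_
  rw [tsum_fintype, Finset.univ_eq_attach, Finset.sum_mul, ← Finset.sum_attach]
  refine Finset.sum_congr rfl fun k _ => ?_
  have := Finset.HasAntidiagonal.mem_antidiagonal.mp k.2
  simp only [Finset.HasAntidiagonal.sigmaAntidiagonalEquivProd_apply]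
  have hz : z ^ n = z ^ k.1.1 * z ^ k.1.2 := by rw [← pow_add, this]
  rw [hz]
  ring

variable {X : Type*} [Group X]

/-- The generating function of the weights of the first returns to the identity along paths
with first step `g` and further steps `f`. -/
def returnGen (f g : X → ℝ≥0∞) (z : ℝ≥0∞) : ℝ≥0∞ := z * genFun (fun n => taboo f g n 1) z

lemma returnGen_mono (f g : X → ℝ≥0∞) : Monotone (returnGen f g) := fun _ _ h =>
  mul_le_mul' h (genFun_mono _ h)

/-- Either alternative in `hx` kills the term for paths that have not yet returned, leaving a pure
Cauchy product. -/
lemma genFun_conv_convPow (f g : X → ℝ≥0∞) (z : ℝ≥0∞) (x : X)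
    (hx : x = 1 ∨ ∀ n, taboo f g n x = 0) :
    z * genFun (fun n => conv g (convPow f n) x) z =
      returnGen f g z * genFun (fun n => convPow f n x) z := by
  have h : ∀ n, conv g (convPow f n) x =
      ∑ k ∈ Finset.HasAntidiagonal.antidiagonal n, taboo f g k.1 1 * convPow f k.2 x := by
    intro n
    rw [conv_convPow_eq_sum_taboo]
    rcases hx with rfl | hx
    · simp
    · simp [hx n]
  simp only [h]
  rw [genFun_antidiagonal (fun k => taboo f g k 1) (fun k => convPow f k x), returnGen, mul_assoc]

lemma genFun_convPow_eq (f : X → ℝ≥0∞) (z : ℝ≥0∞) (x : X) :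
    genFun (fun n => convPow f n x) z =
      unitMass x + z * genFun (fun n => conv f (convPow f n) x) z := by
  rw [genFun_eq_zero_add]
  simp only [convPow_zero, convPow_succ']

end GeneratingFunction

/-! ### Images of mass functions -/

section Push

variable {Γ X : Type*}

/-- The image of a mass function under a map. -/
def push (ι : Γ → X) (m : Γ → ℝ≥0∞) (x : X) : ℝ≥0∞ :=
  open scoped Classical in ∑' a, if x = ι a then m a else 0

lemma push_eq_zero {ι : Γ → X} {m : Γ → ℝ≥0∞} {x : X} (hx : x ∉ range ι) : push ι m x = 0 := by
  classical
  simp only [push, ENNReal.tsum_eq_zero]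
  intro a
  rw [if_neg]
  rintro rfl
  exact hx ⟨a, rfl⟩

lemma tsum_push_mul (ι : Γ → X) (m : Γ → ℝ≥0∞) (h : X → ℝ≥0∞) :
    ∑' x, push ι m x * h x = ∑' a, m a * h (ι a) := by
  classical
  simp only [push, ← ENNReal.tsum_mul_right]
  rw [ENNReal.tsum_comm]
  refine tsum_congr fun a => ?_
  rw [tsum_eq_single (ι a)]
  · simp
  · intro y hy
    simp [hy]

end Push

/-! ### Reduction of a walk to one factor -/

section Factor

variable {Γ X : Type*} [Group Γ] [Group X]

/-- A path can leave `C` only through the identity, and taboo paths do not continue from there. -/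
lemma taboo_support {f g : X → ℝ≥0∞} {C : Set X} (hg : ∀ x, g x ≠ 0 → x ∈ C ∨ x = 1)
    (hC : ∀ x ∈ C, ∀ y, f y ≠ 0 → x * y ∈ C ∨ x * y = 1) (n : ℕ) :
    ∀ x, taboo f g n x ≠ 0 → x ∈ C ∨ x = 1 := by
  classical
  induction n with
  | zero => exact hg
  | succ n ih =>
    intro x hx
    simp only [taboo, conv, ne_eq, ENNReal.tsum_eq_zero, not_forall, mul_eq_zero, not_or] at hx
    obtain ⟨y, hy, hxy⟩ := hx
    by_cases hy1 : y = 1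
    · simp [hy1] at hy
    · rw [if_neg hy1] at hy
      have := hC y ((ih y hy).resolve_right hy1) _ hxy
      rwa [mul_inv_cancel_left] at this

lemma one_sub_inv_eq {U : ℝ≥0∞} (hU : U < 1) : (1 - U)⁻¹ = 1 + U * (1 - U)⁻¹ := by
  have h0 : 1 - U ≠ 0 := (tsub_pos_of_lt hU).ne'
  have ht : 1 - U ≠ ∞ := ENNReal.sub_ne_top ENNReal.one_ne_top
  calc (1 - U)⁻¹ = ((1 - U) + U) * (1 - U)⁻¹ := by
        rw [tsub_add_cancel_of_le hU.le, one_mul]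
    _ = 1 + U * (1 - U)⁻¹ := by rw [add_mul, ENNReal.mul_inv_cancel h0 ht]

/-- Only an inequality, because `A = ∞` satisfies the equation for every `D` when `U ≠ 0`. -/
lemma one_sub_inv_mul_le {U A D : ℝ≥0∞} (hU : U < 1) (h : A = D + U * A) :
    (1 - U)⁻¹ * D ≤ A := by
  have h0 : 1 - U ≠ 0 := (tsub_pos_of_lt hU).ne'
  have ht : 1 - U ≠ ∞ := ENNReal.sub_ne_top ENNReal.one_ne_top
  rcases eq_or_ne A ∞ with hA | hA
  · simp [hA]
  · have hUA : U * A ≠ ∞ := ENNReal.mul_ne_top hU.ne_top hA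
    have hD : D = (1 - U) * A := by
      rw [ENNReal.sub_mul (fun _ _ => hA), one_mul]
      exact ENNReal.eq_sub_of_add_eq hUA h.symm
    rw [hD, ← mul_assoc, ENNReal.inv_mul_cancel h0 ht, one_mul]

lemma genFun_convPow_eq_conv (m : Γ → ℝ≥0∞) (z : ℝ≥0∞) (x : Γ) :
    genFun (fun n => convPow m n x) z =
      unitMass x + z * conv m (fun y => genFun (fun n => convPow m n y) z) x := by
  rw [genFun_convPow_eq]
  simp only [genFun]
  rw [conv_tsum_right]

/-- A truncated Cauchy product is at most the product of the full series with the truncated one. -/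
lemma sum_range_antidiagonal_le (a b : ℕ → ℝ≥0∞) (z : ℝ≥0∞) (N : ℕ) :
    ∑ n ∈ Finset.range N, (∑ k ∈ Finset.HasAntidiagonal.antidiagonal n, a k.1 * b k.2) * z ^ n ≤
      genFun a z * ∑ n ∈ Finset.range N, b n * z ^ n := by
  set b' : ℕ → ℝ≥0∞ := fun n => if n < N then b n else 0 with hb'
  have e : ∑ n ∈ Finset.range N, b n * z ^ n = genFun b' z := by
    rw [genFun, tsum_eq_sum (s := Finset.range N)]
    · refine Finset.sum_congr rfl fun n hn => ?_
      rw [hb']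
      simp only
      rw [if_pos (Finset.mem_range.mp hn)]
    · intro n hn
      simp only [hb']
      rw [if_neg (fun h => hn (Finset.mem_range.mpr h)), zero_mul]
  rw [e, ← genFun_antidiagonal]
  refine le_trans (le_of_eq ?_) (ENNReal.sum_le_tsum (Finset.range N))
  refine Finset.sum_congr rfl fun n hn => ?_
  congr 1
  refine Finset.sum_congr rfl fun k hk => ?_
  have := Finset.HasAntidiagonal.mem_antidiagonal.mp hk
  have hn := Finset.mem_range.mp hn
  simp only [hb']
  rw [if_pos (by omega)]

/-- If a walk on `X` moves either along the factor `Γ` (with weight `a`) or by `g`, and if after a step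
of `g` it can re-enter `Γ` only at the point where it left, then its Green function is that of the
walk on `Γ` after a change of variable. -/
lemma genFun_factor {ι : Γ →* X} (hι : Function.Injective ι) {m : Γ → ℝ≥0∞} {a : ℝ≥0∞}
    {f g : X → ℝ≥0∞} (hf : ∀ x, f x = a * push ι m x + g x)
    (hret : ∀ n x, x ≠ 1 → taboo f g n (ι x) = 0) {z : ℝ≥0∞} (hU : returnGen f g z < 1) :
    genFun (fun n => convPow f n 1) z = (1 - returnGen f g z)⁻¹ *
      genFun (fun n => convPow m n 1) (a * z * (1 - returnGen f g z)⁻¹) := by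
  classical
  set U := returnGen f g z with hUdef
  set c := (1 - U)⁻¹ with hc
  set ζ := a * z * c with hζ
  set A : Γ → ℝ≥0∞ := fun x => genFun (fun n => convPow f n (ι x)) z with hA
  set B : Γ → ℝ≥0∞ := fun x => genFun (fun n => convPow m n x) ζ with hB
  have hconv : ∀ (h : X → ℝ≥0∞) (x : Γ),
      conv f h (ι x) = a * conv m (fun y => h (ι y)) x + conv g h (ι x) := by
    intro h x
    rw [funext hf, conv_add_left]
    congr 1
    simp only [conv, mul_assoc, ENNReal.tsum_mul_left]
    rw [tsum_push_mul ι m fun y => h (y⁻¹ * ι x)]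
    simp
  have hunit : ∀ x : Γ, unitMass (ι x) = unitMass x := by
    intro x
    simp [unitMass, map_eq_one_iff ι hι]
  have hx1 : ∀ x : Γ, ι x = 1 ∨ ∀ n, taboo f g n (ι x) = 0 := by
    intro x
    by_cases hx : x = 1
    · left; simp [hx]
    · right; exact fun n => hret n x hx
  -- Condition on the first step: a step in `Γ` gives the convolution, while a `g`-step must return
  -- to the identity before the path reaches `ι x`.
  have hAeq : ∀ x, A x = (unitMass x + a * z * conv m A x) + U * A x := by
    intro x
    simp only [hA]
    refine (genFun_convPow_eq f z (ι x)).trans ?_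
    rw [hunit]
    simp only [hconv]
    rw [genFun_add, mul_add, genFun_conv_convPow f g z (ι x) (hx1 x), add_assoc]
    congr 2
    simp only [genFun]
    rw [conv_tsum_right, ← ENNReal.tsum_mul_left, ← ENNReal.tsum_mul_left]
    exact tsum_congr fun n => by ring
  have hBeq : ∀ x, B x = unitMass x + ζ * conv m B x := fun x => genFun_convPow_eq_conv m ζ x
  -- Formally `A` and `c * B` solve the same linear equation. Uniqueness is unavailable in `[0, ∞]`,
  -- so the partial sums of each are bounded by the other, by induction.
  have lower : ∀ N x, c * ∑ n ∈ Finset.range N, convPow m n x * ζ ^ n ≤ A x := by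
    intro N
    induction N with
    | zero => simp
    | succ N ih =>
      intro x
      refine le_trans ?_ (one_sub_inv_mul_le hU (hAeq x))
      refine mul_le_mul_right ?_ c
      rw [Finset.sum_range_succ']
      simp only [convPow_zero, pow_zero, mul_one]
      rw [add_comm]
      refine add_le_add le_rfl ?_
      have e : ∑ n ∈ Finset.range N, convPow m (n + 1) x * ζ ^ (n + 1) =
          a * z * conv m (fun y => c * ∑ n ∈ Finset.range N, convPow m n y * ζ ^ n) x := by
        rw [conv_const_mul_right, ← mul_assoc, ← hζ]
        simp only [conv, Finset.mul_sum, convPow_succ']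
        rw [Summable.tsum_finsetSum fun _ _ => ENNReal.summable, Finset.mul_sum]
        refine Finset.sum_congr rfl fun n _ => ?_
        rw [← ENNReal.tsum_mul_right, ← ENNReal.tsum_mul_left]
        exact tsum_congr fun y => by ring
      rw [e]
      exact mul_le_mul_right (conv_mono_right m ih x) _
  have upper : ∀ N x, ∑ n ∈ Finset.range N, convPow f n (ι x) * z ^ n ≤ c * B x := by
    intro N
    induction N with
    | zero => simp
    | succ N ih =>
      intro x
      have hcB : c * B x = (unitMass x + a * z * conv m (fun y => c * B y) x) + U * (c * B x) := by
        rw [conv_const_mul_right, ← mul_assoc, ← hζ, ← hBeq]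
        nth_rewrite 1 [hc]
        rw [one_sub_inv_eq hU, ← hc]
        ring
      rw [hcB, Finset.sum_range_succ']
      simp only [convPow_zero, pow_zero, mul_one, hunit]
      rw [add_comm, add_assoc]
      refine add_le_add le_rfl ?_
      simp only [convPow_succ', hconv, add_mul, Finset.sum_add_distrib]
      refine add_le_add ?_ ?_
      · refine le_trans (le_of_eq ?_) (mul_le_mul_right (conv_mono_right m ih x) _)
        simp only [conv, Finset.mul_sum]
        rw [Summable.tsum_finsetSum fun _ _ => ENNReal.summable, Finset.mul_sum]
        refine Finset.sum_congr rfl fun n _ => ?_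
        rw [← ENNReal.tsum_mul_left, ← ENNReal.tsum_mul_right, ← ENNReal.tsum_mul_left]
        exact tsum_congr fun y => by ring
      · refine le_trans ?_ (mul_le_mul_right (ih x) U)
        have h := sum_range_antidiagonal_le (fun k => taboo f g k 1)
          (fun k => convPow f k (ι x)) z N
        refine le_trans (le_of_eq ?_) (le_trans (mul_le_mul_right h z) (le_of_eq ?_))
        · rw [Finset.mul_sum]
          refine Finset.sum_congr rfl fun n _ => ?_
          rw [conv_convPow_eq_sum_taboo]
          have : (if ι x = 1 then 0 else taboo f g n (ι x)) = 0 := by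
            rcases hx1 x with h | h
            · simp [h]
            · simp [h n]
          rw [this, add_zero]
          ring
        · rw [hUdef, returnGen, mul_assoc]
  have hAB : A 1 = c * B 1 := by
    apply le_antisymm
    · exact ENNReal.tsum_le_of_sum_range_le fun N => upper N 1
    · simp only [hB, genFun]
      rw [← ENNReal.tsum_mul_left]
      refine ENNReal.tsum_le_of_sum_range_le fun N => ?_
      rw [← Finset.mul_sum]
      exact lower N 1
  simpa [hA] using hAB

end Factor

/-! ### The Green function, `zG(z)` and the analyticity of `Φ` -/

section Green

variable {X : Type*} [Group X] {f : X → ℝ≥0∞}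

/-- The Green function at the identity with values in `[0, ∞]`. -/
def greenENN (f : X → ℝ≥0∞) (z : ℝ≥0∞) : ℝ≥0∞ := genFun (fun n => convPow f n 1) z

/-- The interval `[0, r)`, with `r` the radius of convergence of the Green function. -/
def domain (f : X → ℝ≥0∞) : Set ℝ := {z | 0 ≤ z ∧ ENNReal.ofReal z < radius f}

lemma convPow_ne_top (hf : ∑' x, f x ≤ 1) (n : ℕ) (x : X) : convPow f n x ≠ ∞ :=
  ((convPow_le_one hf n x).trans_lt ENNReal.one_lt_top).ne

lemma domain_mono {z w : ℝ} (hz : 0 ≤ z) (hzw : z ≤ w) (hw : w ∈ domain f) : z ∈ domain f :=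
  ⟨hz, (ENNReal.ofReal_le_ofReal hzw).trans_lt hw.2⟩

lemma convex_domain : Convex ℝ (domain f) := by
  refine (ordConnected_of_Ioo ?_).convex
  intro x hx y hy _ z hz
  exact domain_mono (hx.1.trans hz.1.le) hz.2.le hy

lemma one_le_radius (hf : ∑' x, f x ≤ 1) : 1 ≤ radius f := by
  have := FormalMultilinearSeries.le_radius_of_bound
    (FormalMultilinearSeries.ofScalars ℝ fun n : ℕ => (convPow f n 1).toReal) 1 (r := 1) ?_
  · simpa [radius] using this
  · intro n
    rw [FormalMultilinearSeries.ofScalars_norm]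
    simp only [NNReal.coe_one, one_pow, mul_one, Real.norm_eq_abs, abs_of_nonneg ENNReal.toReal_nonneg]
    exact ENNReal.toReal_le_of_le_ofReal zero_le_one (by simpa using convPow_le_one hf n 1)

lemma summable_green {z : ℝ} (hz : z ∈ domain f) :
    Summable fun n : ℕ => (convPow f n 1).toReal * z ^ n := by
  have h := FormalMultilinearSeries.summable_norm_mul_pow
    (FormalMultilinearSeries.ofScalars ℝ fun n : ℕ => (convPow f n 1).toReal) (r := z.toNNReal) hz.2
  simpa [FormalMultilinearSeries.ofScalars_norm, Real.coe_toNNReal z hz.1] using h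

lemma greenENN_ofReal (hf : ∑' x, f x ≤ 1) {z : ℝ} (hz : z ∈ domain f) :
    greenENN f (ENNReal.ofReal z) = ENNReal.ofReal (green f z) := by
  rw [green, ENNReal.ofReal_tsum_of_nonneg
    (fun n => mul_nonneg ENNReal.toReal_nonneg (pow_nonneg hz.1 n)) (summable_green hz), greenENN,
    genFun]
  refine tsum_congr fun n => ?_
  rw [ENNReal.ofReal_mul ENNReal.toReal_nonneg, ENNReal.ofReal_toReal (convPow_ne_top hf n 1),
    ENNReal.ofReal_pow hz.1]

lemma le_radius_of_greenENN_ne_top {z : ℝ} (hz : 0 ≤ z)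
    (h : greenENN f (ENNReal.ofReal z) ≠ ∞) : ENNReal.ofReal z ≤ radius f := by
  refine FormalMultilinearSeries.le_radius_of_summable
    (FormalMultilinearSeries.ofScalars ℝ fun n : ℕ => (convPow f n 1).toReal) (r := z.toNNReal) ?_
  have := ENNReal.summable_toReal h
  refine this.congr fun n => ?_
  rw [FormalMultilinearSeries.ofScalars_norm]
  simp [ENNReal.toReal_mul, ENNReal.toReal_ofReal hz, Real.coe_toNNReal z hz]

lemma zero_mem_domain (hf : ∑' x, f x ≤ 1) : (0 : ℝ) ∈ domain f :=
  ⟨le_rfl, by simpa using zero_lt_one.trans_le (one_le_radius hf)⟩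

lemma convPow_zero_one : convPow f 0 1 = 1 := by simp [convPow_zero, unitMass]

lemma green_zero : green f 0 = 1 := by
  rw [green, tsum_eq_single 0]
  · simp [convPow_zero_one]
  · intro n hn
    simp [hn]

lemma monotoneOn_green : MonotoneOn (green f) (domain f) := by
  intro z hz w hw hzw
  refine (summable_green hz).tsum_le_tsum (fun n => ?_) (summable_green hw)
  have := hz.1
  gcongr

lemma one_le_green (hf : ∑' x, f x ≤ 1) {z : ℝ} (hz : z ∈ domain f) : 1 ≤ green f z :=
  green_zero (f := f) ▸ monotoneOn_green (zero_mem_domain hf) hz hz.1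

lemma analyticAt_green (hf : ∑' x, f x ≤ 1) {z : ℝ} (hz : z ∈ domain f) :
    AnalyticAt ℝ (green f) z := by
  have h := (FormalMultilinearSeries.ofScalars ℝ
    fun n : ℕ => (convPow f n 1).toReal).hasFPowerSeriesOnBall
      (zero_lt_one.trans_le (one_le_radius hf))
  have e : (FormalMultilinearSeries.ofScalars ℝ fun n : ℕ => (convPow f n 1).toReal).sum =
      green f := by
    funext x
    have := FormalMultilinearSeries.ofScalars_sum_eq (E := ℝ)
      (fun n : ℕ => (convPow f n 1).toReal) x
    simpa [FormalMultilinearSeries.ofScalarsSum, green] using this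
  rw [e] at h
  refine h.analyticAt_of_mem ?_
  rw [Metric.mem_eball, edist_dist, Real.dist_eq, sub_zero, abs_of_nonneg hz.1]
  exact hz.2

/-- The function `z G(z)`. -/
def zGreen (f : X → ℝ≥0∞) (z : ℝ) : ℝ := z * green f z

lemma zGreen_nonneg (hf : ∑' x, f x ≤ 1) {z : ℝ} (hz : z ∈ domain f) : 0 ≤ zGreen f z :=
  mul_nonneg hz.1 (zero_le_one.trans (one_le_green hf hz))

lemma strictMonoOn_zGreen (hf : ∑' x, f x ≤ 1) : StrictMonoOn (zGreen f) (domain f) := by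
  intro z hz w hw hzw
  have h1 := one_le_green hf hz
  have h2 := monotoneOn_green hz hw hzw.le
  calc z * green f z < w * green f z := by gcongr
    _ ≤ w * green f w := by have := hw.1; gcongr

lemma analyticAt_zGreen (hf : ∑' x, f x ≤ 1) {z : ℝ} (hz : z ∈ domain f) :
    AnalyticAt ℝ (zGreen f) z := analyticAt_id.mul (analyticAt_green hf hz)

/-- The interval of the nonnegative reals below `θ`. -/
def codomain (f : X → ℝ≥0∞) : Set ℝ := {t | 0 ≤ t ∧ ENNReal.ofReal t < theta f}

lemma theta_eq : theta f = radius f * greenENN f (radius f) := rfl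

lemma one_le_greenENN (z : ℝ≥0∞) : 1 ≤ greenENN f z := by
  rw [greenENN, genFun_eq_zero_add, convPow_zero_one]
  exact le_self_add

lemma theta_pos (hf : ∑' x, f x ≤ 1) : 0 < theta f := by
  rw [theta_eq]
  exact ENNReal.mul_pos (zero_lt_one.trans_le (one_le_radius hf)).ne'
    (zero_lt_one.trans_le (one_le_greenENN _)).ne'

lemma zGreen_mem_codomain (hf : ∑' x, f x ≤ 1) {z : ℝ} (hz : z ∈ domain f) :
    zGreen f z ∈ codomain f := by
  refine ⟨zGreen_nonneg hf hz, ?_⟩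
  rw [zGreen, ENNReal.ofReal_mul hz.1, ← greenENN_ofReal hf hz, theta_eq]
  calc ENNReal.ofReal z * greenENN f (ENNReal.ofReal z)
      < radius f * greenENN f (ENNReal.ofReal z) := by
        refine (ENNReal.mul_lt_mul_iff_left ?_ ?_).mpr hz.2
        · exact (zero_lt_one.trans_le (one_le_greenENN _)).ne'
        · rw [greenENN_ofReal hf hz]; exact ENNReal.ofReal_ne_top
    _ ≤ _ := mul_le_mul_right (genFun_mono _ hz.2.le) _

/-- If `zG(z)` stayed below `t`, letting `z` tend to the radius in each partial sum would give `θ ≤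
t`; the rest is the intermediate value theorem. -/
lemma surjOn_zGreen (hf : ∑' x, f x ≤ 1) (hR : radius f ≠ ∞) :
    SurjOn (zGreen f) (domain f) (codomain f) := by
  intro t ht
  obtain ⟨w, hw, htw⟩ : ∃ w ∈ domain f, t ≤ zGreen f w := by
    by_contra! hcon
    refine absurd ht.2 (not_lt.mpr ?_)
    set R := (radius f).toReal with hRdef
    have hRpos : 0 < R := ENNReal.toReal_pos (zero_lt_one.trans_le (one_le_radius hf)).ne' hR
    have hR' : ENNReal.ofReal R = radius f := ENNReal.ofReal_toReal hR
    rw [theta, ← ENNReal.tsum_mul_left]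
    refine ENNReal.tsum_le_of_sum_range_le fun N => ?_
    have hcont : Continuous fun z : ℝ => z * ∑ n ∈ Finset.range N, (convPow f n 1).toReal * z ^ n := by
      fun_prop
    have hle : R * ∑ n ∈ Finset.range N, (convPow f n 1).toReal * R ^ n ≤ t := by
      have hev : ∀ᶠ z in 𝓝[<] R,
          z * ∑ n ∈ Finset.range N, (convPow f n 1).toReal * z ^ n ≤ t := by
        filter_upwards [Ioo_mem_nhdsLT hRpos] with z hz
        have hzd : z ∈ domain f := ⟨hz.1.le, by
          rw [← hR']; exact (ENNReal.ofReal_lt_ofReal_iff hRpos).mpr hz.2⟩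
        refine le_trans ?_ (hcon z hzd).le
        refine mul_le_mul_of_nonneg_left ?_ hz.1.le
        exact (summable_green hzd).sum_le_tsum _
          fun n _ => mul_nonneg ENNReal.toReal_nonneg (pow_nonneg hzd.1 n)
      exact le_of_tendsto (hcont.continuousAt.tendsto.mono_left nhdsWithin_le_nhds) hev
    refine le_trans (le_of_eq ?_) (ENNReal.ofReal_le_ofReal hle)
    rw [← Finset.mul_sum, ENNReal.ofReal_mul hRpos.le, hR', ENNReal.ofReal_sum_of_nonneg
      fun n _ => mul_nonneg ENNReal.toReal_nonneg (pow_nonneg hRpos.le n)]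
    congr 1
    refine Finset.sum_congr rfl fun n _ => ?_
    rw [ENNReal.ofReal_mul ENNReal.toReal_nonneg, ENNReal.ofReal_toReal (convPow_ne_top hf n 1),
      ENNReal.ofReal_pow hRpos.le, hR']
  have hsub : Icc 0 w ⊆ domain f := fun z hz => domain_mono hz.1 hz.2 hw
  have hcont : ContinuousOn (zGreen f) (Icc 0 w) := fun z hz =>
    (analyticAt_zGreen hf (hsub hz)).continuousAt.continuousWithinAt
  obtain ⟨z, hz, hzt⟩ := intermediate_value_Icc hw.1 hcont
    (show t ∈ Icc (zGreen f 0) (zGreen f w) from ⟨by simpa [zGreen] using ht.1, htw⟩)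
  exact ⟨z, hsub hz, hzt⟩

lemma phi_zGreen (hf : ∑' x, f x ≤ 1) {z : ℝ} (hz : z ∈ domain f) :
    phi f (zGreen f z) = green f z :=
  congrArg (green f) ((strictMonoOn_zGreen hf).injOn.leftInvOn_invFunOn hz)

lemma deriv_zGreen (hf : ∑' x, f x ≤ 1) {z : ℝ} (hz : z ∈ domain f) :
    deriv (zGreen f) z = green f z + z * deriv (green f) z := by
  have h : HasDerivAt (zGreen f) (1 * green f z + z * deriv (green f) z) z :=
    (hasDerivAt_id z).mul (analyticAt_green hf hz).differentiableAt.hasDerivAt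
  simpa using h.deriv

lemma eventually_mem_domain {z : ℝ} (hz : z ∈ domain f) :
    ∀ᶠ w in 𝓝 z, ENNReal.ofReal w < radius f :=
  (ENNReal.continuous_ofReal.tendsto z).eventually (gt_mem_nhds hz.2)

lemma deriv_green_nonneg (hf : ∑' x, f x ≤ 1) {z : ℝ} (hz : z ∈ domain f) :
    0 ≤ deriv (green f) z := by
  have hd := (analyticAt_green hf hz).differentiableAt.hasDerivAt
  have h1 : Tendsto (slope (green f) z) (𝓝[>] z) (𝓝 (deriv (green f) z)) :=
    (hasDerivWithinAt_iff_tendsto_slope' (by simp)).mp hd.hasDerivWithinAt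
  refine ge_of_tendsto h1 ?_
  filter_upwards [(eventually_mem_domain hz).filter_mono nhdsWithin_le_nhds,
    self_mem_nhdsWithin] with w hw hzw
  have hzw : z < w := hzw
  rw [slope_def_field]
  exact div_nonneg (sub_nonneg.mpr (monotoneOn_green hz ⟨hz.1.trans hzw.le, hw⟩ hzw.le))
    (sub_nonneg.mpr hzw.le)

lemma deriv_zGreen_pos (hf : ∑' x, f x ≤ 1) {z : ℝ} (hz : z ∈ domain f) :
    0 < deriv (zGreen f) z := by
  rw [deriv_zGreen hf hz]
  have := one_le_green hf hz
  have := mul_nonneg hz.1 (deriv_green_nonneg hf hz)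
  linarith

/-- Near `z G(z)` the function `Φ` agrees on `[0, ∞)` with an analytic function. -/
lemma exists_analyticAt_phi (hf : ∑' x, f x ≤ 1) {z : ℝ} (hz : z ∈ domain f) :
    ∃ φ : ℝ → ℝ, AnalyticAt ℝ φ (zGreen f z) ∧
      ∀ᶠ t in 𝓝 (zGreen f z), 0 ≤ t → phi f t = φ t := by
  have hW := analyticAt_zGreen hf hz
  have hW' := (deriv_zGreen_pos hf hz).ne'
  set r := hW.hasStrictDerivAt.localInverse _ _ _ hW' with hr
  have hra : AnalyticAt ℝ r (zGreen f z) := hW.analyticAt_localInverse hW'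
  have hrz : r (zGreen f z) = z := HasStrictFDerivAt.localInverse_apply_image ..
  have hright : ∀ᶠ t in 𝓝 (zGreen f z), zGreen f (r t) = t :=
    HasStrictDerivAt.eventually_right_inverse ..
  have hgr : AnalyticAt ℝ (green f) (r (zGreen f z)) := hrz.symm ▸ analyticAt_green hf hz
  have hrc : Tendsto r (𝓝 (zGreen f z)) (𝓝 z) := by
    have := hra.continuousAt.tendsto
    rwa [hrz] at this
  refine ⟨fun t => green f (r t), hgr.comp hra, ?_⟩
  have hpos : ∀ᶠ w in 𝓝 z, 0 < green f w :=
    (analyticAt_green hf hz).continuousAt.eventually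
      (lt_mem_nhds (zero_lt_one.trans_le (one_le_green hf hz)))
  filter_upwards [hright, hrc.eventually hpos, hrc.eventually (eventually_mem_domain hz)]
    with t ht h1 h2 h0
  -- The local inverse may leave `[0, r)` on the left; `0 ≤ t` and positivity of `G` near `z`
  -- prevent this.
  have hd : r t ∈ domain f := by
    refine ⟨?_, h2⟩
    by_contra! hneg
    have : zGreen f (r t) < 0 := mul_neg_of_neg_of_pos hneg h1
    linarith
  rw [← phi_zGreen hf hd, ht]

lemma analyticAt_phi (hf : ∑' x, f x ≤ 1) {z : ℝ} (hz : z ∈ domain f) (hz0 : 0 < z) :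
    AnalyticAt ℝ (phi f) (zGreen f z) := by
  obtain ⟨φ, hφ, he⟩ := exists_analyticAt_phi hf hz
  have hpos : 0 < zGreen f z := mul_pos hz0 (zero_lt_one.trans_le (one_le_green hf hz))
  refine hφ.congr ?_
  filter_upwards [he, lt_mem_nhds hpos] with t h1 h2
  exact (h1 h2.le).symm

/-- One-sided because `z = 0` is allowed and `phi` has no meaning at negative arguments. -/
lemma analyticWithinAt_phi (hf : ∑' x, f x ≤ 1) {z : ℝ} (hz : z ∈ domain f) :
    AnalyticWithinAt ℝ (phi f) (Ici 0) (zGreen f z) := by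
  obtain ⟨φ, hφ, he⟩ := exists_analyticAt_phi hf hz
  refine hφ.analyticWithinAt.congr_of_eventuallyEq ?_ (he.self_of_nhds (zGreen_nonneg hf hz))
  filter_upwards [he.filter_mono nhdsWithin_le_nhds, self_mem_nhdsWithin] with t h1 h2
  exact h1 h2

end Green

/-! ### Convexity of the return function and the behaviour of `Ψ` -/

section Psi

variable {X : Type*} [Group X] {f : X → ℝ≥0∞}

lemma greenENN_renewal (f : X → ℝ≥0∞) (z : ℝ≥0∞) :
    greenENN f z = 1 + returnGen f f z * greenENN f z := by
  refine (genFun_convPow_eq f z 1).trans ?_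
  rw [genFun_conv_convPow f f z 1 (Or.inl rfl)]
  simp [unitMass, greenENN]

lemma hasSum_return (hf : ∑' x, f x ≤ 1) {z : ℝ} (hz : z ∈ domain f) :
    HasSum (fun n => (taboo f f n 1).toReal * z ^ (n + 1)) (1 - (green f z)⁻¹) := by
  have h := greenENN_renewal f (ENNReal.ofReal z)
  have hg := one_le_green hf hz
  have hG : greenENN f (ENNReal.ofReal z) ≠ ∞ := by
    rw [greenENN_ofReal hf hz]; exact ENNReal.ofReal_ne_top
  set U := returnGen f f (ENNReal.ofReal z) with hU
  have hUG : U * greenENN f (ENNReal.ofReal z) ≠ ∞ := by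
    intro h'
    rw [h'] at h
    exact hG (by simpa using h)
  have hUtop : U ≠ ∞ := by
    refine ne_top_of_le_ne_top hUG ?_
    calc U = U * 1 := (mul_one U).symm
      _ ≤ _ := mul_le_mul_right (one_le_greenENN _) U
  have hUval : U.toReal = 1 - (green f z)⁻¹ := by
    have h2 := congrArg ENNReal.toReal h
    rw [ENNReal.toReal_add ENNReal.one_ne_top hUG, ENNReal.toReal_mul, greenENN_ofReal hf hz,
      ENNReal.toReal_ofReal (zero_le_one.trans hg), ENNReal.toReal_one] at h2
    field_simp
    linarith
  have hUsum : U = ∑' n, taboo f f n 1 * ENNReal.ofReal z ^ (n + 1) := by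
    rw [hU, returnGen, genFun, ← ENNReal.tsum_mul_left]
    exact tsum_congr fun n => by ring
  have hne : ∑' n, taboo f f n 1 * ENNReal.ofReal z ^ (n + 1) ≠ ∞ := hUsum ▸ hUtop
  have h3 := (ENNReal.summable_toReal hne).hasSum
  rw [← ENNReal.tsum_toReal_eq (fun n => ENNReal.ne_top_of_tsum_ne_top hne n), ← hUsum,
    hUval] at h3
  convert h3 using 2 with n
  rw [ENNReal.toReal_mul, ENNReal.toReal_pow, ENNReal.toReal_ofReal hz.1]

lemma taboo_le_one (hf : ∑' x, f x ≤ 1) (n : ℕ) : taboo f f n 1 ≤ 1 := by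
  refine le_trans ?_ (convPow_le_one hf (n + 1) 1)
  rw [convPow_succ', conv_convPow_eq_sum_taboo]
  simp only [if_true, add_zero]
  refine le_trans (le_of_eq ?_) (Finset.single_le_sum (fun _ _ => zero_le) (a := (n, 0))
    (Finset.HasAntidiagonal.mem_antidiagonal.mpr (by simp)))
  simp [convPow_zero_one]

/-- An irreducible walk on a nontrivial group can return to its starting point without doing so in
its first step. -/
lemma IsIrreducibleWalk.exists_taboo_ne_zero [Nontrivial X] (h : IsIrreducibleWalk f)
    (hf : ∑' x, f x ≤ 1) : ∃ n, 1 ≤ n ∧ taboo f f n 1 ≠ 0 := by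
  classical
  by_contra! hcon
  obtain ⟨x, hx1, hx⟩ : ∃ x, x ≠ 1 ∧ f x ≠ 0 := by
    by_contra! hno
    have : Function.support f ⊆ ((⊥ : Submonoid X) : Set X) := by
      intro y hy
      by_contra hy1
      exact hy (hno y hy1)
    have h2 := Submonoid.closure_le.mpr this
    rw [h] at h2
    obtain ⟨y, hy⟩ := exists_ne (1 : X)
    exact hy (Submonoid.mem_bot.mp (h2 (Submonoid.mem_top y)))
  obtain ⟨m, hm⟩ : ∃ m, convPow f m x⁻¹ ≠ 0 := by
    have hmem : x⁻¹ ∈ Submonoid.closure (Function.support f) := by rw [h]; trivial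
    generalize x⁻¹ = y at hmem
    induction hmem using Submonoid.closure_induction_right with
    | one => exact ⟨0, by simp [convPow_zero_one]⟩
    | mul_right a _ b hb ih =>
      obtain ⟨m, hm⟩ := ih
      refine ⟨m + 1, ?_⟩
      rw [convPow_succ, conv, Ne, ENNReal.tsum_eq_zero]
      intro h0
      have := h0 a
      rw [inv_mul_cancel_left] at this
      exact mul_ne_zero hm hb this
  -- With no first return of length at least 2, every return starts with a step that stays at the
  -- identity; the path through `x` contradicts this.
  have h1 : conv f (convPow f m) 1 = f 1 * convPow f m 1 := by
    rw [conv_convPow_eq_sum_taboo, Finset.sum_eq_single (0, m)]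
    · simp [taboo]
    · rintro ⟨k, l⟩ hk hne
      have hkl := Finset.HasAntidiagonal.mem_antidiagonal.mp hk
      have : 1 ≤ k := by
        rcases Nat.eq_zero_or_pos k with rfl | hk0
        · exact absurd (by simpa using hkl) (fun e => hne (Prod.ext rfl e))
        · exact hk0
      simp [hcon k this]
    · intro hn
      exact absurd (Finset.HasAntidiagonal.mem_antidiagonal.mpr (by simp)) hn
  have h2 : f 1 * convPow f m 1 + f x * convPow f m x⁻¹ ≤ conv f (convPow f m) 1 := by
    refine le_trans (le_of_eq ?_) (ENNReal.sum_le_tsum {1, x})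
    rw [Finset.sum_pair hx1.symm]
    simp
  have hfin : f 1 * convPow f m 1 ≠ ∞ :=
    ENNReal.mul_ne_top (((ENNReal.le_tsum 1).trans hf).trans_lt ENNReal.one_lt_top).ne
      (convPow_ne_top hf m 1)
  rw [h1] at h2
  have h3 : f x * convPow f m x⁻¹ ≤ 0 :=
    (ENNReal.add_le_add_iff_left hfin).mp (by simpa using h2)
  exact mul_ne_zero hx hm (le_antisymm h3 zero_le)

/-- On the domain the return series equals `1 - 1/G < 1`, while a single positive term of it would
exceed this bound for large `z`. -/
lemma radius_ne_top (hf : ∑' x, f x ≤ 1) (hu : ∃ n, 1 ≤ n ∧ taboo f f n 1 ≠ 0) :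
    radius f ≠ ∞ := by
  intro hR
  obtain ⟨n, -, hn⟩ := hu
  set u := (taboo f f n 1).toReal with hudef
  have hu0 : 0 < u := ENNReal.toReal_pos hn ((taboo_le_one hf n).trans_lt ENNReal.one_lt_top).ne
  set z := max 1 u⁻¹ with hzdef
  have hz1 : 1 ≤ z := le_max_left _ _
  have hz : z ∈ domain f := ⟨zero_le_one.trans hz1, by rw [hR]; exact ENNReal.ofReal_lt_top⟩
  have hs := hasSum_return hf hz
  have h1 : u * z ^ (n + 1) ≤ 1 - (green f z)⁻¹ :=
    le_hasSum hs n fun k _ => mul_nonneg ENNReal.toReal_nonneg (pow_nonneg hz.1 _)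
  have h2 : 1 ≤ u * z ^ (n + 1) := by
    calc (1 : ℝ) = u * u⁻¹ := (mul_inv_cancel₀ hu0.ne').symm
      _ ≤ u * z ^ (n + 1) := by
        gcongr
        exact (le_max_right _ _).trans (le_self_pow₀ hz1 (Nat.succ_ne_zero n))
  have h3 : 0 < (green f z)⁻¹ := inv_pos.mpr (zero_lt_one.trans_le (one_le_green hf hz))
  linarith

lemma strictConvexOn_return (hf : ∑' x, f x ≤ 1) (hu : ∃ n, 1 ≤ n ∧ taboo f f n 1 ≠ 0) :
    StrictConvexOn ℝ (domain f) fun z => 1 - (green f z)⁻¹ := by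
  refine ⟨convex_domain, ?_⟩
  intro x hx y hy hxy a b ha hb hab
  have hxy' := convex_domain hx hy ha.le hb.le hab
  have hsx := (hasSum_return hf hx).mul_left a
  have hsy := (hasSum_return hf hy).mul_left b
  obtain ⟨n, hn1, hn⟩ := hu
  have hun : 0 < (taboo f f n 1).toReal :=
    ENNReal.toReal_pos hn ((taboo_le_one hf n).trans_lt ENNReal.one_lt_top).ne
  refine hasSum_lt (fun k => ?_) (i := n) ?_ (hasSum_return hf hxy') (hsx.add hsy)
  · have hc := (convexOn_pow (𝕜 := ℝ) (k + 1)).2 hx.1 hy.1 ha.le hb.le hab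
    simp only [smul_eq_mul] at hc ⊢
    have := mul_le_mul_of_nonneg_left hc (ENNReal.toReal_nonneg (a := taboo f f k 1))
    linarith
  -- The index `n` belongs to the power `z ^ (n + 1)`, so `1 ≤ n` is what makes this term strictly
  -- convex.
  · have hc := (strictConvexOn_pow (show 2 ≤ n + 1 by omega)).2 hx.1 hy.1 hxy ha hb hab
    simp only [smul_eq_mul] at hc ⊢
    have := mul_lt_mul_of_pos_left hc hun
    linarith

/-- The intercept with the vertical axis of the tangent of `1 / G` at `z`. -/
def tangentIntercept (f : X → ℝ≥0∞) (z : ℝ) : ℝ :=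
  (green f z)⁻¹ + z * deriv (green f) z / green f z ^ 2

/-- The chord slope of the strictly convex `1 - 1/G` lies strictly between the end slopes; since `z
≥ 0`, the tangent at `w` meets the axis strictly above the one at `z`. -/
lemma strictMonoOn_tangentIntercept (hf : ∑' x, f x ≤ 1)
    (hu : ∃ n, 1 ≤ n ∧ taboo f f n 1 ≠ 0) : StrictMonoOn (tangentIntercept f) (domain f) := by
  intro z hz w hw hzw
  have hd : ∀ x ∈ domain f, HasDerivAt (fun z => 1 - (green f z)⁻¹)
      (deriv (green f) x / green f x ^ 2) x := by
    intro x hx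
    have h1 := (analyticAt_green hf hx).differentiableAt.hasDerivAt
    have h2 := (h1.fun_inv (zero_lt_one.trans_le (one_le_green hf hx)).ne').const_sub 1
    simpa [neg_div] using h2
  have hc := strictConvexOn_return hf hu
  have h1 := hc.lt_slope_of_hasDerivAt hz hw hzw (hd z hz)
  have h2 := hc.slope_lt_of_hasDerivAt hz hw hzw (hd w hw)
  have h3 : z * (deriv (green f) z / green f z ^ 2) ≤ z * (deriv (green f) w / green f w ^ 2) :=
    mul_le_mul_of_nonneg_left (h1.trans h2).le hz.1
  rw [slope_def_field, div_lt_iff₀ (sub_pos.mpr hzw)] at h2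
  simp only [tangentIntercept, mul_div_assoc]
  linarith

lemma one_le_tangentIntercept (hf : ∑' x, f x ≤ 1) (hu : ∃ n, 1 ≤ n ∧ taboo f f n 1 ≠ 0)
    {z : ℝ} (hz : z ∈ domain f) : 1 ≤ tangentIntercept f z := by
  have := (strictMonoOn_tangentIntercept hf hu).monotoneOn (zero_mem_domain hf) hz hz.1
  simpa [tangentIntercept, green_zero] using this

lemma continuousOn_tangentIntercept (hf : ∑' x, f x ≤ 1) :
    ContinuousOn (tangentIntercept f) (domain f) := by
  intro z hz
  have hg := analyticAt_green hf hz
  have h0 := (zero_lt_one.trans_le (one_le_green hf hz)).ne'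
  exact ((hg.continuousAt.inv₀ h0).add ((continuousAt_id.mul hg.deriv.continuousAt).div
    (hg.continuousAt.pow 2) (pow_ne_zero 2 h0))).continuousWithinAt

/-- `Φ(t) - t Φ'(t)`. -/
def phiIntercept (f : X → ℝ≥0∞) (t : ℝ) : ℝ := phi f t - t * deriv (phi f) t

/-- Differentiating `Φ(zG) = G` gives `Φ' = G'/(G + zG')`, so both sides equal `G²/(G + zG')`. -/
lemma phiIntercept_zGreen (hf : ∑' x, f x ≤ 1) {z : ℝ} (hz : z ∈ domain f) :
    phiIntercept f (zGreen f z) = (tangentIntercept f z)⁻¹ := by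
  rw [phiIntercept, phi_zGreen hf hz]
  rcases hz.1.eq_or_lt with h0 | hz0
  -- At `t = 0` the two-sided derivative of `phi` is uncontrolled, but it is multiplied by zero.
  · simp [← h0, zGreen, tangentIntercept, green_zero]
  have hg := one_le_green hf hz
  have hW := deriv_zGreen hf hz
  have hWpos := deriv_zGreen_pos hf hz
  have hchain := (analyticAt_phi hf hz hz0).differentiableAt.hasDerivAt.comp z
    (analyticAt_zGreen hf hz).differentiableAt.hasDerivAt
  have heq : phi f ∘ zGreen f =ᶠ[𝓝 z] green f := by
    filter_upwards [eventually_mem_domain hz, lt_mem_nhds hz0] with w hw hw0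
    exact phi_zGreen hf ⟨hw0.le, hw⟩
  have hd : deriv (phi f) (zGreen f z) * deriv (zGreen f) z = deriv (green f) z :=
    (hchain.congr_of_eventuallyEq heq.symm).deriv.symm
  rw [hW] at hd hWpos
  have hd' : deriv (phi f) (zGreen f z) =
      deriv (green f) z / (green f z + z * deriv (green f) z) := by
    rw [eq_div_iff hWpos.ne', hd]
  have hg0 : green f z ≠ 0 := by positivity
  have ht : tangentIntercept f z = (green f z + z * deriv (green f) z) / green f z ^ 2 := by
    rw [tangentIntercept]
    field_simp
  rw [hd', ht, inv_div, zGreen]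
  field_simp
  ring

lemma analyticOn_phi (hf : ∑' x, f x ≤ 1) (hu : ∃ n, 1 ≤ n ∧ taboo f f n 1 ≠ 0) :
    AnalyticOn ℝ (phi f) (codomain f) := by
  intro t ht
  obtain ⟨z, hz, rfl⟩ := surjOn_zGreen hf (radius_ne_top hf hu) ht
  exact (analyticWithinAt_phi hf hz).mono fun s hs => hs.1

lemma differentiableAt_phi (hf : ∑' x, f x ≤ 1) (hu : ∃ n, 1 ≤ n ∧ taboo f f n 1 ≠ 0) {t : ℝ}
    (ht : t ∈ codomain f) (ht0 : 0 < t) : DifferentiableAt ℝ (phi f) t := by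
  obtain ⟨z, hz, rfl⟩ := surjOn_zGreen hf (radius_ne_top hf hu) ht
  refine (analyticAt_phi hf hz ?_).differentiableAt
  refine hz.1.lt_of_ne ?_
  rintro rfl
  simp [zGreen] at ht0

lemma strictAntiOn_phiIntercept (hf : ∑' x, f x ≤ 1) (hu : ∃ n, 1 ≤ n ∧ taboo f f n 1 ≠ 0) :
    StrictAntiOn (phiIntercept f) (codomain f) := by
  intro s hs t ht hst
  obtain ⟨z, hz, rfl⟩ := surjOn_zGreen hf (radius_ne_top hf hu) hs
  obtain ⟨w, hw, rfl⟩ := surjOn_zGreen hf (radius_ne_top hf hu) ht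
  rw [phiIntercept_zGreen hf hz, phiIntercept_zGreen hf hw]
  have hzw := ((strictMonoOn_zGreen hf).lt_iff_lt hz hw).mp hst
  exact inv_strictAnti₀ (zero_lt_one.trans_le (one_le_tangentIntercept hf hu hz))
    (strictMonoOn_tangentIntercept hf hu hz hw hzw)

lemma phiIntercept_pos (hf : ∑' x, f x ≤ 1) (hu : ∃ n, 1 ≤ n ∧ taboo f f n 1 ≠ 0) {t : ℝ}
    (ht : t ∈ codomain f) : 0 < phiIntercept f t := by
  obtain ⟨z, hz, rfl⟩ := surjOn_zGreen hf (radius_ne_top hf hu) ht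
  rw [phiIntercept_zGreen hf hz]
  exact inv_pos.mpr (zero_lt_one.trans_le (one_le_tangentIntercept hf hu hz))

lemma continuousOn_phiIntercept (hf : ∑' x, f x ≤ 1) (hu : ∃ n, 1 ≤ n ∧ taboo f f n 1 ≠ 0) :
    ContinuousOn (phiIntercept f) (codomain f) := by
  have hsurj := surjOn_zGreen hf (radius_ne_top hf hu)
  -- The inverse of `zG(z)` is explicit: `z = t / Φ(t)`, hence continuous.
  have hinv : ∀ t ∈ codomain f, t / phi f t ∈ domain f ∧ zGreen f (t / phi f t) = t ∧
      phi f t ≠ 0 := by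
    intro t ht
    obtain ⟨z, hz, rfl⟩ := hsurj ht
    have hg0 : green f z ≠ 0 := (zero_lt_one.trans_le (one_le_green hf hz)).ne'
    have : zGreen f z / phi f (zGreen f z) = z := by
      rw [phi_zGreen hf hz, zGreen, mul_div_cancel_right₀ _ hg0]
    rw [this, phi_zGreen hf hz]
    exact ⟨hz, rfl, hg0⟩
  have hcont : ContinuousOn (fun t => t / phi f t) (codomain f) :=
    continuousOn_id.div (analyticOn_phi hf hu).continuousOn fun t ht => (hinv t ht).2.2
  have hK : ContinuousOn (fun t => (tangentIntercept f (t / phi f t))⁻¹) (codomain f) :=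
    ((continuousOn_tangentIntercept hf).comp hcont fun t ht => (hinv t ht).1).inv₀
      fun t ht => (zero_lt_one.trans_le (one_le_tangentIntercept hf hu (hinv t ht).1)).ne'
  refine hK.congr fun t ht => ?_
  conv_lhs => rw [← (hinv t ht).2.1]
  exact phiIntercept_zGreen hf (hinv t ht).1

lemma psi_eq_phiIntercept {t : ℝ} (ht : t ∈ codomain f) : psi f t = phiIntercept f t := by
  rw [psi, if_pos ht.2, phiIntercept]

lemma mem_codomain_iff (hθ : theta f ≠ ∞) {t : ℝ} :
    t ∈ codomain f ↔ 0 ≤ t ∧ t < (theta f).toReal := by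
  refine and_congr_right fun h0 => ?_
  rw [ENNReal.ofReal_lt_iff_lt_toReal h0 hθ]

/-- A decreasing function bounded below by 0 has a left limit, so the `limUnder` in `psi` is a
genuine limit. -/
lemma tendsto_phiIntercept (hf : ∑' x, f x ≤ 1) (hu : ∃ n, 1 ≤ n ∧ taboo f f n 1 ≠ 0)
    (hθ : theta f ≠ ∞) :
    Tendsto (phiIntercept f) (𝓝[<] (theta f).toReal) (𝓝 (psi f (theta f).toReal)) := by
  have hpos : 0 < (theta f).toReal := ENNReal.toReal_pos (theta_pos hf).ne' hθ
  have hsub : Ioo 0 (theta f).toReal ⊆ codomain f := fun t ht =>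
    (mem_codomain_iff hθ).mpr ⟨ht.1.le, ht.2⟩
  have h := ((strictAntiOn_phiIntercept hf hu).antitoneOn.mono hsub).tendsto_nhdsWithin_Ioo_left
    (nonempty_Ioo.mpr hpos) ⟨0, by
      rintro _ ⟨t, ht, rfl⟩
      exact (phiIntercept_pos hf hu (hsub ht)).le⟩
  have e : psi f (theta f).toReal = limUnder (𝓝[<] (theta f).toReal) (phiIntercept f) := by
    rw [psi, if_neg]
    · rfl
    · rw [ENNReal.ofReal_toReal hθ]
      exact lt_irrefl _
  rw [e, h.limUnder_eq]
  exact h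

/-- The closed counterpart of `codomain`: the nonnegative reals not exceeding `θ`. -/
def closedCodomain (f : X → ℝ≥0∞) : Set ℝ := {t | 0 ≤ t ∧ ENNReal.ofReal t ≤ theta f}

lemma codomain_subset : codomain f ⊆ closedCodomain f := fun _ ht => ⟨ht.1, ht.2.le⟩

lemma eq_of_notMem_codomain {t : ℝ} (ht : t ∈ closedCodomain f) (ht' : t ∉ codomain f) :
    theta f ≠ ∞ ∧ t = (theta f).toReal := by
  have h : ENNReal.ofReal t = theta f :=
    le_antisymm ht.2 (not_lt.mp fun h => ht' ⟨ht.1, h⟩)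
  rw [← h]
  exact ⟨ENNReal.ofReal_ne_top, (ENNReal.toReal_ofReal ht.1).symm⟩

lemma mem_codomain_of_lt {s t : ℝ} (hs : 0 ≤ s) (ht : t ∈ closedCodomain f) (hst : s < t) :
    s ∈ codomain f :=
  ⟨hs, ((ENNReal.ofReal_lt_ofReal_iff (hs.trans_lt hst)).mpr hst).trans_le ht.2⟩

lemma strictAntiOn_psi (hf : ∑' x, f x ≤ 1) (hu : ∃ n, 1 ≤ n ∧ taboo f f n 1 ≠ 0) :
    StrictAntiOn (psi f) (closedCodomain f) := by
  intro s hs t ht hst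
  have hs' := mem_codomain_of_lt hs.1 ht hst
  by_cases ht' : t ∈ codomain f
  · rw [psi_eq_phiIntercept hs', psi_eq_phiIntercept ht']
    exact strictAntiOn_phiIntercept hf hu hs' ht' hst
  · obtain ⟨hθ, rfl⟩ := eq_of_notMem_codomain ht ht'
    -- The intermediate point keeps the inequality strict after passing to the limit.
    obtain ⟨m, hsm, hmt⟩ := exists_between hst
    have hm := mem_codomain_of_lt (hs.1.trans hsm.le) ht hmt
    rw [psi_eq_phiIntercept hs']
    refine lt_of_le_of_lt ?_ (strictAntiOn_phiIntercept hf hu hs' hm hsm)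
    refine le_of_tendsto (tendsto_phiIntercept hf hu hθ) ?_
    filter_upwards [Ioo_mem_nhdsLT hmt] with x hx
    exact (strictAntiOn_phiIntercept hf hu hm
      (mem_codomain_of_lt (hm.1.trans hx.1.le) ht hx.2) hx.1).le

lemma continuousOn_psi (hf : ∑' x, f x ≤ 1) (hu : ∃ n, 1 ≤ n ∧ taboo f f n 1 ≠ 0) :
    ContinuousOn (psi f) (closedCodomain f) := by
  intro t ht
  by_cases ht' : t ∈ codomain f
  · have h := ((continuousOn_phiIntercept hf hu).congr fun s hs => psi_eq_phiIntercept hs) t ht'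
    refine h.mono_of_mem_nhdsWithin ?_
    filter_upwards [self_mem_nhdsWithin, nhdsWithin_le_nhds
      ((ENNReal.continuous_ofReal.tendsto t).eventually (gt_mem_nhds ht'.2))] with s hs1 hs2
    exact ⟨hs1.1, hs2⟩
  · obtain ⟨hθ, rfl⟩ := eq_of_notMem_codomain ht ht'
    have hpos : 0 < (theta f).toReal := ENNReal.toReal_pos (theta_pos hf).ne' hθ
    have h1 : ContinuousWithinAt (psi f) (Iio (theta f).toReal) (theta f).toReal := by
      refine (tendsto_phiIntercept hf hu hθ).congr' ?_
      filter_upwards [Ioo_mem_nhdsLT hpos] with s hs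
      exact (psi_eq_phiIntercept ((mem_codomain_iff hθ).mpr ⟨hs.1.le, hs.2⟩)).symm
    refine (continuousWithinAt_insert_self.mpr h1).mono fun s hs => ?_
    rw [mem_insert_iff]
    exact ((ENNReal.ofReal_le_iff_le_toReal hθ).mp hs.2).eq_or_lt

end Psi

/-! ### Last letters of reduced words -/

section Cone

open Monoid Monoid.CoprodI

variable {ι : Type*} {M : ι → Type*} [∀ i, Group (M i)]

/-- The index of the last letter of a reduced word. -/
def lastIdx (w : Word M) : Option ι := w.toList.getLast?.map Sigma.fst

lemma lastIdx_eq_none {w : Word M} : lastIdx w = none ↔ w = Word.empty := by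
  rw [lastIdx, Option.map_eq_none_iff, List.getLast?_eq_none_iff, Word.ext_iff]
  rfl

variable [∀ i, DecidableEq (M i)]

lemma lastIdx_rcons {i : ι} (p : Word.Pair M i) :
    lastIdx (Word.rcons p) = (lastIdx p.tail <|> if p.head = 1 then none else some i) := by
  rw [Word.rcons]
  split_ifs with h
  · simp
  · simp only [lastIdx, Word.cons, List.getLast?_cons]
    cases p.tail.toList.getLast? <;> simp

variable [DecidableEq ι]

/-- Left multiplication by a letter affects only the front of the word, so the last index survives
unless everything cancels. -/
lemma lastIdx_of_smul {i j : ι} (m : M i) {w : Word M} (hw : lastIdx w = some j) :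
    lastIdx (of m • w) = some j ∨ of m • w = Word.empty := by
  rw [← lastIdx_eq_none, Word.of_smul_def, lastIdx_rcons]
  rw [← (Word.equivPair i).symm_apply_apply w, Word.equivPair_symm, lastIdx_rcons] at hw
  cases h : lastIdx (Word.equivPair i w).tail with
  | some k => simp_all
  | none =>
    rw [h] at hw
    split_ifs at hw ⊢ <;> simp_all

lemma lastIdx_of_smul_empty {i : ι} (m : M i) :
    lastIdx (of m • (Word.empty : Word M)) = if m = 1 then none else some i := by
  rw [Word.of_smul_def, lastIdx_rcons, Word.equivPair_eq_of_fstIdx_ne (by simp [Word.fstIdx, Word.empty])]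
  simp [lastIdx, Word.empty]

end Cone

/-! ### Cones in the binary free product -/

section FreeProductCone

open Monoid

variable (Γ₁ : Type*) (Γ₂ : Type*) [Group Γ₁] [Group Γ₂]

/-- The two factors as a family over `Bool`. -/
def factor.{u, v} (Γ₁ : Type u) (Γ₂ : Type v) : Bool → Type (max u v)
  | false => ULift.{v} Γ₁
  | true => ULift.{u} Γ₂

instance (b : Bool) : Group (factor Γ₁ Γ₂ b) :=
  match b with
  | false => inferInstanceAs (Group (ULift Γ₁))
  | true => inferInstanceAs (Group (ULift Γ₂))

/-- The embedding of the first factor into the family. -/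
def inFalse : Γ₁ →* factor Γ₁ Γ₂ false := (MulEquiv.ulift (α := Γ₁)).symm.toMonoidHom

/-- The embedding of the second factor into the family. -/
def inTrue : Γ₂ →* factor Γ₁ Γ₂ true := (MulEquiv.ulift (α := Γ₂)).symm.toMonoidHom

/-- The binary free product as a free product of a family over `Bool`. -/
def toCoprodI : Coprod Γ₁ Γ₂ →* CoprodI (factor Γ₁ Γ₂) :=
  Coprod.lift (CoprodI.of.comp (inFalse Γ₁ Γ₂)) (CoprodI.of.comp (inTrue Γ₁ Γ₂))

/-- The inverse of `toCoprodI`. -/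
def ofCoprodI : CoprodI (factor Γ₁ Γ₂) →* Coprod Γ₁ Γ₂ :=
  CoprodI.lift fun b => match b with
  | false => Coprod.inl.comp (MulEquiv.ulift (α := Γ₁)).toMonoidHom
  | true => Coprod.inr.comp (MulEquiv.ulift (α := Γ₂)).toMonoidHom

lemma ofCoprodI_toCoprodI (x : Coprod Γ₁ Γ₂) : ofCoprodI Γ₁ Γ₂ (toCoprodI Γ₁ Γ₂ x) = x := by
  have : (ofCoprodI Γ₁ Γ₂).comp (toCoprodI Γ₁ Γ₂) = MonoidHom.id _ := by
    apply Coprod.hom_ext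
    · ext g
      simp [toCoprodI, ofCoprodI]
      rfl
    · ext g
      simp [toCoprodI, ofCoprodI]
      rfl
  exact DFunLike.congr_fun this x

variable {Γ₁ Γ₂}

open scoped Classical in
/-- The elements of the free product whose reduced word starts with a letter of the factor `b`. -/
def cone (b : Bool) : Set (Coprod Γ₁ Γ₂) :=
  {x | lastIdx ((toCoprodI Γ₁ Γ₂ x)⁻¹ • (CoprodI.Word.empty : CoprodI.Word (factor Γ₁ Γ₂))) = some b}

/-- Inversion turns right multiplication into the left action on words and first letters into last
ones, so `lastIdx_of_smul` applies. -/
lemma cone_mul {b : Bool} {x y : Coprod Γ₁ Γ₂} (hx : x ∈ cone b)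
    (hy : y ∈ range (Coprod.inl : Γ₁ →* Coprod Γ₁ Γ₂) ∪ range (Coprod.inr : Γ₂ →* Coprod Γ₁ Γ₂)) :
    x * y ∈ cone b ∨ x * y = 1 := by
  classical
  obtain ⟨i, m, hm⟩ : ∃ (i : Bool) (m : factor Γ₁ Γ₂ i), (toCoprodI Γ₁ Γ₂ y)⁻¹ = CoprodI.of m := by
    rcases hy with ⟨g, rfl⟩ | ⟨g, rfl⟩
    · exact ⟨false, (inFalse Γ₁ Γ₂ g)⁻¹, by simp [toCoprodI]⟩
    · exact ⟨true, (inTrue Γ₁ Γ₂ g)⁻¹, by simp [toCoprodI]⟩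
  have key := lastIdx_of_smul m (w := (toCoprodI Γ₁ Γ₂ x)⁻¹ • CoprodI.Word.empty) hx
  rw [← hm, ← mul_smul, ← mul_inv_rev, ← map_mul] at key
  refine key.imp id fun h => ?_
  have h1 := congrArg CoprodI.Word.prod h
  rw [CoprodI.Word.prod_smul, CoprodI.Word.prod_empty, mul_one, inv_eq_one] at h1
  rw [← ofCoprodI_toCoprodI Γ₁ Γ₂ (x * y), h1, map_one]

lemma inl_mem_cone {b : Bool} {g : Γ₁} :
    (Coprod.inl g : Coprod Γ₁ Γ₂) ∈ cone b ↔ b = false ∧ g ≠ 1 := by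
  classical
  have e : (toCoprodI Γ₁ Γ₂ (Coprod.inl g))⁻¹ = CoprodI.of ((inFalse Γ₁ Γ₂ g)⁻¹) := by
    simp [toCoprodI]
  have e1 : (inFalse Γ₁ Γ₂ g)⁻¹ = 1 ↔ g = 1 := by
    rw [inv_eq_one]
    exact MulEquiv.map_eq_one_iff _
  rw [cone, mem_ofPred_eq, e, lastIdx_of_smul_empty]
  by_cases h : g = 1 <;> simp [e1, h, eq_comm]

lemma inr_mem_cone {b : Bool} {g : Γ₂} :
    (Coprod.inr g : Coprod Γ₁ Γ₂) ∈ cone b ↔ b = true ∧ g ≠ 1 := by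
  classical
  have e : (toCoprodI Γ₁ Γ₂ (Coprod.inr g))⁻¹ = CoprodI.of ((inTrue Γ₁ Γ₂ g)⁻¹) := by
    simp [toCoprodI]
  have e1 : (inTrue Γ₁ Γ₂ g)⁻¹ = 1 ↔ g = 1 := by
    rw [inv_eq_one]
    exact MulEquiv.map_eq_one_iff _
  rw [cone, mem_ofPred_eq, e, lastIdx_of_smul_empty]
  by_cases h : g = 1 <;> simp [e1, h, eq_comm]

end FreeProductCone

/-! ### The factor reduction in terms of `Φ` -/

section FactorReal

variable {Γ X : Type*} [Group Γ] [Group X]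

/-- With `c = 1/(1 - U)` and `ζ = azc`, the relation `G(z) = c Gₘ(ζ)` gives `azG(z) = ζGₘ(ζ)`, so
`Φₘ` there is `Gₘ(ζ) = G(z)(1 - U)`. -/
lemma phi_factor {ι : Γ →* X} (hι : Function.Injective ι) {m : Γ → ℝ≥0∞} {a : ℝ} (ha : 0 < a)
    {f g : X → ℝ≥0∞} (hf : ∀ x, f x = ENNReal.ofReal a * push ι m x + g x)
    (hret : ∀ n x, x ≠ 1 → taboo f g n (ι x) = 0) (hfs : ∑' x, f x ≤ 1) (hms : ∑' x, m x ≤ 1)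
    (hlt : ∀ z ∈ domain f, returnGen f g (ENNReal.ofReal z) < 1) {z : ℝ} (hz : z ∈ domain f) :
    a * zGreen f z ∈ codomain m ∧ phi m (a * zGreen f z) =
      green f z * (1 - (returnGen f g (ENNReal.ofReal z)).toReal) := by
  set c : ℝ → ℝ≥0∞ := fun z => (1 - returnGen f g (ENNReal.ofReal z))⁻¹ with hc
  set ζ : ℝ → ℝ≥0∞ := fun z => ENNReal.ofReal a * ENNReal.ofReal z * c z with hζ
  have hfac : ∀ w ∈ domain f, ENNReal.ofReal (green f w) = c w * greenENN m (ζ w) := by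
    intro w hw
    rw [← greenENN_ofReal hfs hw]
    exact genFun_factor hι hf hret (hlt w hw)
  have hctop : ∀ w ∈ domain f, c w ≠ ∞ := fun w hw =>
    ENNReal.inv_ne_top.mpr (tsub_pos_of_lt (hlt w hw)).ne'
  have hc1 : ∀ w, 1 ≤ c w := fun w => ENNReal.one_le_inv.mpr tsub_le_self
  have hζtop : ∀ w ∈ domain f, ζ w ≠ ∞ := fun w hw =>
    ENNReal.mul_ne_top (ENNReal.mul_ne_top ENNReal.ofReal_ne_top ENNReal.ofReal_ne_top) (hctop w hw)
  have hle : ∀ w ∈ domain f, ζ w ≤ radius m := by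
    intro w hw
    have h := le_radius_of_greenENN_ne_top (f := m) (z := (ζ w).toReal) ENNReal.toReal_nonneg
    rw [ENNReal.ofReal_toReal (hζtop w hw)] at h
    refine h (ne_top_of_le_ne_top (ENNReal.ofReal_ne_top (r := green f w)) ?_)
    rw [hfac w hw]
    exact le_mul_of_one_le_left' (hc1 w)
  -- Finiteness of the Green function at `ζ` only gives `ζ ≤ radius m`; comparison with a larger
  -- point `q` makes it strict.
  obtain ⟨q, hzq, hq⟩ := exists_between hz.2
  have hqtop : q ≠ ∞ := hq.ne_top
  have hqd : q.toReal ∈ domain f := ⟨ENNReal.toReal_nonneg, by rwa [ENNReal.ofReal_toReal hqtop]⟩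
  have hζlt : ζ z < radius m := by
    refine lt_of_lt_of_le ?_ (hle _ hqd)
    have hcmono : c z ≤ c q.toReal := by
      refine ENNReal.inv_le_inv.mpr (tsub_le_tsub_left (returnGen_mono f g ?_) 1)
      rw [ENNReal.ofReal_toReal hqtop]
      exact hzq.le
    calc ζ z < ENNReal.ofReal a * q * c z := by
          refine (ENNReal.mul_lt_mul_iff_left (zero_lt_one.trans_le (hc1 z)).ne' (hctop z hz)).mpr ?_
          exact (ENNReal.mul_lt_mul_iff_right (ENNReal.ofReal_pos.mpr ha).ne'
            ENNReal.ofReal_ne_top).mpr hzq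
      _ ≤ ENNReal.ofReal a * q * c q.toReal := mul_le_mul_right hcmono _
      _ = ζ q.toReal := by simp only [hζ, ENNReal.ofReal_toReal hqtop]
  have hζd : (ζ z).toReal ∈ domain m :=
    ⟨ENNReal.toReal_nonneg, by rwa [ENNReal.ofReal_toReal (hζtop z hz)]⟩
  have hζr : (ζ z).toReal = a * z * (c z).toReal := by
    simp only [hζ, ENNReal.toReal_mul, ENNReal.toReal_ofReal ha.le, ENNReal.toReal_ofReal hz.1]
  have hg : green f z = (c z).toReal * green m (ζ z).toReal := by
    have h := hfac z hz
    nth_rewrite 1 [← ENNReal.ofReal_toReal (hζtop z hz)] at h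
    rw [greenENN_ofReal hms hζd] at h
    have h2 := congrArg ENNReal.toReal h
    rwa [ENNReal.toReal_mul, ENNReal.toReal_ofReal (zero_le_one.trans (one_le_green hfs hz)),
      ENNReal.toReal_ofReal (zero_le_one.trans (one_le_green hms hζd))] at h2
  have hW : a * zGreen f z = zGreen m (ζ z).toReal := by
    rw [zGreen, zGreen, hg, hζr]
    ring
  have hcr : (c z).toReal * (1 - (returnGen f g (ENNReal.ofReal z)).toReal) = 1 := by
    have hlt' := hlt z hz
    have hne : (1 - returnGen f g (ENNReal.ofReal z)).toReal ≠ 0 :=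
      (ENNReal.toReal_pos (tsub_pos_of_lt hlt').ne'
        (ENNReal.sub_ne_top ENNReal.one_ne_top)).ne'
    rw [ENNReal.toReal_sub_of_le hlt'.le ENNReal.one_ne_top, ENNReal.toReal_one] at hne
    rw [hc]
    simp only
    rw [ENNReal.toReal_inv, ENNReal.toReal_sub_of_le hlt'.le ENNReal.one_ne_top,
      ENNReal.toReal_one, inv_mul_cancel₀ hne]
  rw [hW, phi_zGreen hms hζd]
  refine ⟨zGreen_mem_codomain hms hζd, ?_⟩
  calc green m (ζ z).toReal = ((c z).toReal *
      (1 - (returnGen f g (ENNReal.ofReal z)).toReal)) * green m (ζ z).toReal := by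
        rw [hcr, one_mul]
    _ = _ := by rw [hg]; ring

end FactorReal

/-! ### The walk on the free product -/

section FreeProduct

open Monoid

variable {Γ₁ Γ₂ : Type*} [Group Γ₁] [Group Γ₂] {μ₁ : PMF Γ₁} {μ₂ : PMF Γ₂} {α : ℝ}

lemma map_eq_push {Γ X : Type*} (ι : Γ → X) (μ : PMF Γ) : ⇑(μ.map ι) = push ι μ := by
  funext x
  rw [PMF.map_apply, push]

lemma freeStep_eq (x : Coprod Γ₁ Γ₂) : freeStep μ₁ μ₂ α x =
    ENNReal.ofReal α * push Coprod.inl μ₁ x + ENNReal.ofReal (1 - α) * push Coprod.inr μ₂ x := by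
  rw [freeStep, map_eq_push, map_eq_push]

lemma tsum_freeStep (hα : α ∈ Ioo (0 : ℝ) 1) : ∑' x, freeStep μ₁ μ₂ α x ≤ 1 := by
  simp only [freeStep]
  rw [ENNReal.tsum_add, ENNReal.tsum_mul_left, ENNReal.tsum_mul_left, PMF.tsum_coe, PMF.tsum_coe,
    mul_one, mul_one, ← ENNReal.ofReal_add hα.1.le (sub_nonneg.mpr hα.2.le)]
  simp

lemma mem_range_of_freeStep_ne_zero {x : Coprod Γ₁ Γ₂} (hx : freeStep μ₁ μ₂ α x ≠ 0) :
    x ∈ range (Coprod.inl : Γ₁ →* Coprod Γ₁ Γ₂) ∪ range (Coprod.inr : Γ₂ →* Coprod Γ₁ Γ₂) := by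
  by_contra h
  rw [mem_union, not_or] at h
  rw [freeStep_eq, push_eq_zero h.1, push_eq_zero h.2] at hx
  simp at hx

/-- A path whose first step is in `Γ₂` stays among words beginning in `Γ₂` until it hits the
identity, so it cannot reach `Γ₁` elsewhere. -/
lemma taboo_inl (c : ℝ≥0∞) (n : ℕ) (x : Γ₁) (hx : x ≠ 1) :
    taboo (freeStep μ₁ μ₂ α) (fun y => c * push Coprod.inr μ₂ y) n (Coprod.inl x) = 0 := by
  by_contra h
  refine absurd (taboo_support (C := cone true) (fun y hy => ?_)
    (fun y hy w hw => cone_mul hy (mem_range_of_freeStep_ne_zero hw)) n _ h) ?_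
  · obtain ⟨g, rfl⟩ : y ∈ range (Coprod.inr : Γ₂ →* Coprod Γ₁ Γ₂) := by
      by_contra hy'
      exact hy (by rw [push_eq_zero hy', mul_zero])
    by_cases hg : g = 1
    · right; simp [hg]
    · left; exact inr_mem_cone.mpr ⟨rfl, hg⟩
  · rintro (h1 | h1)
    · exact Bool.noConfusion (inl_mem_cone.mp h1).1
    · exact hx ((map_eq_one_iff _ Coprod.inl_injective).mp h1)

lemma taboo_inr (c : ℝ≥0∞) (n : ℕ) (x : Γ₂) (hx : x ≠ 1) :
    taboo (freeStep μ₁ μ₂ α) (fun y => c * push Coprod.inl μ₁ y) n (Coprod.inr x) = 0 := by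
  by_contra h
  refine absurd (taboo_support (C := cone false) (fun y hy => ?_)
    (fun y hy w hw => cone_mul hy (mem_range_of_freeStep_ne_zero hw)) n _ h) ?_
  · obtain ⟨g, rfl⟩ : y ∈ range (Coprod.inl : Γ₁ →* Coprod Γ₁ Γ₂) := by
      by_contra hy'
      exact hy (by rw [push_eq_zero hy', mul_zero])
    by_cases hg : g = 1
    · right; simp [hg]
    · left; exact inl_mem_cone.mpr ⟨rfl, hg⟩
  · rintro (h1 | h1)
    · exact Bool.noConfusion (inr_mem_cone.mp h1).1
    · exact hx ((map_eq_one_iff _ Coprod.inr_injective).mp h1)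

/-- The Green function of the free product in terms of the functions `Φᵢ` of the factors. -/
lemma phi_freeStep (hα : α ∈ Ioo (0 : ℝ) 1) {z : ℝ} (hz : z ∈ domain (freeStep μ₁ μ₂ α)) :
    α * zGreen (freeStep μ₁ μ₂ α) z ∈ codomain μ₁ ∧
    (1 - α) * zGreen (freeStep μ₁ μ₂ α) z ∈ codomain μ₂ ∧
    green (freeStep μ₁ μ₂ α) z = phi μ₁ (α * zGreen (freeStep μ₁ μ₂ α) z) +
      phi μ₂ ((1 - α) * zGreen (freeStep μ₁ μ₂ α) z) - 1 := by
  set f := freeStep μ₁ μ₂ α with hf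
  set g₁ : Coprod Γ₁ Γ₂ → ℝ≥0∞ := fun y => ENNReal.ofReal α * push Coprod.inl μ₁ y with hg₁
  set g₂ : Coprod Γ₁ Γ₂ → ℝ≥0∞ := fun y => ENNReal.ofReal (1 - α) * push Coprod.inr μ₂ y with hg₂
  have hfs : ∑' x, f x ≤ 1 := tsum_freeStep hα
  have hsum : ∀ z : ℝ≥0∞, greenENN f z =
      1 + (returnGen f g₁ z + returnGen f g₂ z) * greenENN f z := by
    intro z
    refine (genFun_convPow_eq f z 1).trans ?_
    have e : ∀ n, conv f (convPow f n) 1 = conv g₁ (convPow f n) 1 + conv g₂ (convPow f n) 1 := by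
      intro n
      rw [← conv_add_left]
      congr 1
      exact funext freeStep_eq
    simp only [e]
    rw [genFun_add, mul_add, genFun_conv_convPow f g₁ z 1 (Or.inl rfl),
      genFun_conv_convPow f g₂ z 1 (Or.inl rfl), ← add_mul]
    simp [unitMass, greenENN]
  have hlt : ∀ w ∈ domain f,
      returnGen f g₁ (ENNReal.ofReal w) + returnGen f g₂ (ENNReal.ofReal w) < 1 := by
    intro w hw
    by_contra! hge
    have h1 := hsum (ENNReal.ofReal w)
    have hfin : greenENN f (ENNReal.ofReal w) ≠ ∞ := by
      rw [greenENN_ofReal hfs hw]; exact ENNReal.ofReal_ne_top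
    -- A total return weight of at least 1 is incompatible with the renewal equation for finite `G`.
    have h2 : 1 + greenENN f (ENNReal.ofReal w) ≤ greenENN f (ENNReal.ofReal w) := by
      conv_rhs => rw [h1]
      gcongr
      exact le_mul_of_one_le_left' hge
    have h3 := ENNReal.lt_add_right hfin one_ne_zero
    rw [add_comm] at h2
    exact absurd h3 (not_lt.mpr h2)
  obtain ⟨hm1, hp1⟩ := phi_factor Coprod.inl_injective hα.1 (f := f) (g := g₂) freeStep_eq
    (taboo_inl _) hfs (PMF.tsum_coe μ₁).le (fun w hw => le_add_self.trans_lt (hlt w hw)) hz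
  obtain ⟨hm2, hp2⟩ := phi_factor Coprod.inr_injective (sub_pos.mpr hα.2) (f := f) (g := g₁)
    (fun x => (freeStep_eq x).trans (add_comm _ _))
    (taboo_inr _) hfs (PMF.tsum_coe μ₂).le (fun w hw => le_self_add.trans_lt (hlt w hw)) hz
  refine ⟨hm1, hm2, ?_⟩
  have h := congrArg ENNReal.toReal (hsum (ENNReal.ofReal z))
  have hU := hlt z hz
  have hU1 := (le_self_add.trans_lt hU).ne_top
  have hU2 := (le_add_self.trans_lt hU).ne_top
  rw [greenENN_ofReal hfs hz, ENNReal.toReal_add ENNReal.one_ne_top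
    (ENNReal.mul_ne_top hU.ne_top ENNReal.ofReal_ne_top), ENNReal.toReal_mul,
    ENNReal.toReal_add hU1 hU2, ENNReal.toReal_ofReal (zero_le_one.trans (one_le_green hfs hz)),
    ENNReal.toReal_one] at h
  rw [hp1, hp2]
  linarith

end FreeProduct

/-! ### Monotonicity of `Υ` and its identification with `Ψ(θ̄)` -/

section Upsilon

variable {Γ₁ Γ₂ : Type*} [Group Γ₁] [Group Γ₂] {μ₁ : PMF Γ₁} {μ₂ : PMF Γ₂} {α : ℝ}

lemma thetaBar_mem (hα : α ∈ Ioo (0 : ℝ) 1) (hfin : thetaBar μ₁ μ₂ α < ∞) :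
    α * (thetaBar μ₁ μ₂ α).toReal ∈ closedCodomain μ₁ ∧
    (1 - α) * (thetaBar μ₁ μ₂ α).toReal ∈ closedCodomain μ₂ := by
  have hα' : 0 < 1 - α := sub_pos.mpr hα.2
  refine ⟨⟨mul_nonneg hα.1.le ENNReal.toReal_nonneg, ?_⟩,
    ⟨mul_nonneg hα'.le ENNReal.toReal_nonneg, ?_⟩⟩
  · rw [ENNReal.ofReal_mul hα.1.le, ENNReal.ofReal_toReal hfin.ne]
    refine (mul_le_mul_right (min_le_left _ _) _).trans ?_
    rw [ENNReal.mul_div_cancel (ENNReal.ofReal_pos.mpr hα.1).ne' ENNReal.ofReal_ne_top]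
  · rw [ENNReal.ofReal_mul hα'.le, ENNReal.ofReal_toReal hfin.ne]
    refine (mul_le_mul_right (min_le_right _ _) _).trans ?_
    rw [ENNReal.mul_div_cancel (ENNReal.ofReal_pos.mpr hα').ne' ENNReal.ofReal_ne_top]

lemma thetaBar_toReal_pos (hfin : thetaBar μ₁ μ₂ α < ∞) : 0 < (thetaBar μ₁ μ₂ α).toReal := by
  refine ENNReal.toReal_pos (lt_min ?_ ?_).ne' hfin.ne
  · exact ENNReal.div_pos (theta_pos (PMF.tsum_coe μ₁).le).ne' ENNReal.ofReal_ne_top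
  · exact ENNReal.div_pos (theta_pos (PMF.tsum_coe μ₂).le).ne' ENNReal.ofReal_ne_top

lemma continuousOn_thetaBar (hfin : ∀ α ∈ Ioo (0 : ℝ) 1, thetaBar μ₁ μ₂ α < ∞) :
    ContinuousOn (fun α => (thetaBar μ₁ μ₂ α).toReal) (Ioo 0 1) := by
  intro α hα
  have hcont : ContinuousAt (thetaBar μ₁ μ₂) α := by
    refine Tendsto.min ?_ ?_
    · exact ENNReal.Tendsto.const_div (ENNReal.continuous_ofReal.tendsto α)
        (Or.inl ENNReal.ofReal_ne_top)
    · exact ENNReal.Tendsto.const_div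
        ((ENNReal.continuous_ofReal.comp (continuous_const.sub continuous_id)).tendsto α)
        (Or.inl ENNReal.ofReal_ne_top)
  exact ContinuousAt.continuousWithinAt ((ENNReal.tendsto_toReal (hfin α hα).ne).comp hcont)

lemma continuousOn_upsilon (hu₁ : ∃ n, 1 ≤ n ∧ taboo μ₁ μ₁ n 1 ≠ 0)
    (hu₂ : ∃ n, 1 ≤ n ∧ taboo μ₂ μ₂ n 1 ≠ 0)
    (hfin : ∀ α ∈ Ioo (0 : ℝ) 1, thetaBar μ₁ μ₂ α < ∞) :
    ContinuousOn (upsilon μ₁ μ₂) (Ioo 0 1) := by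
  have hT := continuousOn_thetaBar hfin
  refine ((((continuousOn_psi (PMF.tsum_coe μ₁).le hu₁).comp (continuousOn_id.mul hT)
    fun α hα => (thetaBar_mem hα (hfin α hα)).1)).add
    (((continuousOn_psi (PMF.tsum_coe μ₂).le hu₂).comp
      ((continuousOn_const.sub continuousOn_id).mul hT)
    fun α hα => (thetaBar_mem hα (hfin α hα)).2))).sub continuousOn_const

lemma theta_toReal_pos {Γ : Type*} [Group Γ] {μ : PMF Γ} (h : theta μ ≠ ∞) :
    0 < (theta μ).toReal :=
  ENNReal.toReal_pos (theta_pos (PMF.tsum_coe μ).le).ne' h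

lemma alphaCrit_eq_div (h₁ : theta μ₁ ≠ ∞) (h₂ : theta μ₂ ≠ ∞) :
    alphaCrit μ₁ μ₂ = (theta μ₁).toReal / ((theta μ₁).toReal + (theta μ₂).toReal) := by
  rw [alphaCrit, if_neg h₁, ENNReal.toReal_div, ENNReal.toReal_add h₁ h₂]

lemma theta_div_ofReal {Γ : Type*} [Group Γ] {μ : PMF Γ} (h : theta μ ≠ ∞) {a : ℝ} (ha : 0 < a) :
    theta μ / ENNReal.ofReal a = ENNReal.ofReal ((theta μ).toReal / a) := by
  rw [ENNReal.ofReal_div_of_pos ha, ENNReal.ofReal_toReal h]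

lemma thetaBar_of_le (hα : α ∈ Ioo (0 : ℝ) 1) (hle : α ≤ alphaCrit μ₁ μ₂) :
    (thetaBar μ₁ μ₂ α).toReal = (theta μ₂).toReal / (1 - α) := by
  have hα' : 0 < 1 - α := sub_pos.mpr hα.2
  rw [thetaBar]
  by_cases h₁ : theta μ₁ = ∞
  · rw [h₁, ENNReal.top_div_of_ne_top ENNReal.ofReal_ne_top, min_eq_right le_top,
      ENNReal.toReal_div, ENNReal.toReal_ofReal hα'.le]
  have h₂ : theta μ₂ ≠ ∞ := by
    intro h₂
    rw [alphaCrit, if_neg h₁, h₂] at hle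
    simp only [add_top, ENNReal.div_top, ENNReal.toReal_zero] at hle
    exact absurd hle (not_le.mpr hα.1)
  rw [alphaCrit_eq_div h₁ h₂, le_div_iff₀ (add_pos (theta_toReal_pos h₁) (theta_toReal_pos h₂))] at hle
  rw [theta_div_ofReal h₁ hα.1, theta_div_ofReal h₂ hα', min_eq_right, ENNReal.toReal_ofReal]
  · exact div_nonneg ENNReal.toReal_nonneg hα'.le
  · refine ENNReal.ofReal_le_ofReal ?_
    rw [div_le_div_iff₀ hα' hα.1]
    linarith

lemma thetaBar_of_ge (hα : α ∈ Ioo (0 : ℝ) 1) (hle : alphaCrit μ₁ μ₂ ≤ α) :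
    (thetaBar μ₁ μ₂ α).toReal = (theta μ₁).toReal / α := by
  have hα' : 0 < 1 - α := sub_pos.mpr hα.2
  rw [thetaBar]
  have h₁ : theta μ₁ ≠ ∞ := by
    intro h₁
    rw [alphaCrit, if_pos h₁] at hle
    exact absurd hle (not_le.mpr hα.2)
  by_cases h₂ : theta μ₂ = ∞
  · rw [h₂, ENNReal.top_div_of_ne_top ENNReal.ofReal_ne_top, min_eq_left le_top,
      ENNReal.toReal_div, ENNReal.toReal_ofReal hα.1.le]
  rw [alphaCrit_eq_div h₁ h₂, div_le_iff₀ (add_pos (theta_toReal_pos h₁) (theta_toReal_pos h₂))] at hle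
  rw [theta_div_ofReal h₁ hα.1, theta_div_ofReal h₂ hα', min_eq_left, ENNReal.toReal_ofReal]
  · exact div_nonneg ENNReal.toReal_nonneg hα.1.le
  · refine ENNReal.ofReal_le_ofReal ?_
    rw [div_le_div_iff₀ hα.1 hα']
    linarith

lemma strictAntiOn_upsilon (hu₁ : ∃ n, 1 ≤ n ∧ taboo μ₁ μ₁ n 1 ≠ 0)
    (hfin : ∀ α ∈ Ioo (0 : ℝ) 1, thetaBar μ₁ μ₂ α < ∞) :
    StrictAntiOn (upsilon μ₁ μ₂) (Ioo 0 1 ∩ Ioc 0 (alphaCrit μ₁ μ₂)) := by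
  rintro s ⟨hs, hs'⟩ t ⟨ht, ht'⟩ hst
  have h1s : 0 < 1 - s := sub_pos.mpr hs.2
  have h1t : 0 < 1 - t := sub_pos.mpr ht.2
  have hTs := thetaBar_of_le hs hs'.2
  have hTt := thetaBar_of_le ht ht'.2
  have hlt : (thetaBar μ₁ μ₂ s).toReal < (thetaBar μ₁ μ₂ t).toReal := by
    have hpos := thetaBar_toReal_pos (hfin s hs)
    rw [hTs] at hpos ⊢
    rw [hTt]
    -- Positivity of `θ̄` excludes the default value `0` that `toReal` takes at `∞`.
    have hb : 0 < (theta μ₂).toReal := (div_pos_iff_of_pos_right h1s).mp hpos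
    exact div_lt_div_of_pos_left hb h1t (by linarith)
  have hmul : s * (thetaBar μ₁ μ₂ s).toReal < t * (thetaBar μ₁ μ₂ t).toReal :=
    mul_lt_mul'' hst hlt hs.1.le ENNReal.toReal_nonneg
  have hψ := strictAntiOn_psi (PMF.tsum_coe μ₁).le hu₁ (thetaBar_mem hs (hfin s hs)).1
    (thetaBar_mem ht (hfin t ht)).1 hmul
  have e : (1 - s) * (thetaBar μ₁ μ₂ s).toReal = (1 - t) * (thetaBar μ₁ μ₂ t).toReal := by
    rw [hTs, hTt, mul_div_cancel₀ _ h1s.ne', mul_div_cancel₀ _ h1t.ne']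
  rw [upsilon, upsilon, e]
  linarith

lemma strictMonoOn_upsilon (hu₂ : ∃ n, 1 ≤ n ∧ taboo μ₂ μ₂ n 1 ≠ 0)
    (hfin : ∀ α ∈ Ioo (0 : ℝ) 1, thetaBar μ₁ μ₂ α < ∞) :
    StrictMonoOn (upsilon μ₁ μ₂) (Ioo 0 1 ∩ Ico (alphaCrit μ₁ μ₂) 1) := by
  rintro s ⟨hs, hs'⟩ t ⟨ht, ht'⟩ hst
  have h1s : 0 < 1 - s := sub_pos.mpr hs.2
  have h1t : 0 < 1 - t := sub_pos.mpr ht.2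
  have hTs := thetaBar_of_ge hs hs'.1
  have hTt := thetaBar_of_ge ht ht'.1
  have hlt : (thetaBar μ₁ μ₂ t).toReal < (thetaBar μ₁ μ₂ s).toReal := by
    have hpos := thetaBar_toReal_pos (hfin s hs)
    rw [hTs] at hpos ⊢
    rw [hTt]
    have hb : 0 < (theta μ₁).toReal := (div_pos_iff_of_pos_right hs.1).mp hpos
    exact div_lt_div_of_pos_left hb hs.1 hst
  have hmul : (1 - t) * (thetaBar μ₁ μ₂ t).toReal < (1 - s) * (thetaBar μ₁ μ₂ s).toReal :=
    mul_lt_mul'' (by linarith) hlt h1t.le ENNReal.toReal_nonneg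
  have hψ := strictAntiOn_psi (PMF.tsum_coe μ₂).le hu₂ (thetaBar_mem ht (hfin t ht)).2
    (thetaBar_mem hs (hfin s hs)).2 hmul
  have e : s * (thetaBar μ₁ μ₂ s).toReal = t * (thetaBar μ₁ μ₂ t).toReal := by
    rw [hTs, hTt, mul_div_cancel₀ _ hs.1.ne', mul_div_cancel₀ _ ht.1.ne']
  rw [upsilon, upsilon, e]
  linarith

lemma tendsto_psi_mul {Γ : Type*} [Group Γ] {μ : PMF Γ} (hu : ∃ n, 1 ≤ n ∧ taboo μ μ n 1 ≠ 0)
    {a T : ℝ} (ha : 0 < a) (hT : 0 < T) (hmem : a * T ∈ closedCodomain μ) :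
    Tendsto (fun t => psi μ (a * t)) (𝓝[<] T) (𝓝 (psi μ (a * T))) := by
  refine ((continuousOn_psi (PMF.tsum_coe μ).le hu) _ hmem).tendsto.comp ?_
  refine tendsto_nhdsWithin_iff.mpr ⟨?_, ?_⟩
  · exact ((continuous_const.mul continuous_id).tendsto T).mono_left nhdsWithin_le_nhds
  · filter_upwards [Ioo_mem_nhdsLT hT] with t ht
    exact codomain_subset (mem_codomain_of_lt (mul_nonneg ha.le ht.1.le) hmem
      (mul_lt_mul_of_pos_left ht.2 ha))

lemma hasDerivAt_phi_mul {Γ : Type*} [Group Γ] {μ : PMF Γ}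
    (hu : ∃ n, 1 ≤ n ∧ taboo μ μ n 1 ≠ 0) {a t : ℝ} (ha : 0 < a) (ht : 0 < t)
    (hmem : a * t ∈ codomain μ) :
    HasDerivAt (fun t => phi μ (a * t)) (deriv (phi μ) (a * t) * a) t := by
  have h1 := (differentiableAt_phi (PMF.tsum_coe μ).le hu hmem (mul_pos ha ht)).hasDerivAt
  have h2 : HasDerivAt (fun t => a * t) a t := by
    simpa using (hasDerivAt_id t).const_mul a
  exact h1.comp t h2

/-- For `Φ(t) = Φ₁(αt) + Φ₂((1 - α)t) - 1` the chain rule gives `Φ(t) - tΦ'(t) = Ψ₁(αt) + Ψ₂((1 -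
α)t) - 1`; continuity of the `Ψᵢ` up to the endpoint finishes. -/
lemma isPsiThetaBar_upsilon (hu₁ : ∃ n, 1 ≤ n ∧ taboo μ₁ μ₁ n 1 ≠ 0)
    (hu₂ : ∃ n, 1 ≤ n ∧ taboo μ₂ μ₂ n 1 ≠ 0) (hα : α ∈ Ioo (0 : ℝ) 1)
    (hfin : thetaBar μ₁ μ₂ α < ∞) : IsPsiThetaBar μ₁ μ₂ α (upsilon μ₁ μ₂ α) := by
  have hα' : 0 < 1 - α := sub_pos.mpr hα.2
  have hs₁ := (PMF.tsum_coe μ₁).le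
  have hs₂ := (PMF.tsum_coe μ₂).le
  set T := (thetaBar μ₁ μ₂ α).toReal with hT
  have hTpos : 0 < T := thetaBar_toReal_pos hfin
  obtain ⟨hc₁, hc₂⟩ := thetaBar_mem hα hfin
  have hd₁ : ∀ t ∈ Ico 0 T, α * t ∈ codomain μ₁ := fun t ht =>
    mem_codomain_of_lt (mul_nonneg hα.1.le ht.1) hc₁ (mul_lt_mul_of_pos_left ht.2 hα.1)
  have hd₂ : ∀ t ∈ Ico 0 T, (1 - α) * t ∈ codomain μ₂ := fun t ht =>
    mem_codomain_of_lt (mul_nonneg hα'.le ht.1) hc₂ (mul_lt_mul_of_pos_left ht.2 hα')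
  refine ⟨fun t => phi μ₁ (α * t) + phi μ₂ ((1 - α) * t) - 1, ?_, ?_, ?_⟩
  · have hlin : ∀ a : ℝ, AnalyticOn ℝ (fun t => a * t) (Ico 0 T) := fun a =>
      analyticOn_const.mul analyticOn_id
    exact (((analyticOn_phi hs₁ hu₁).comp (hlin α) hd₁).add
      ((analyticOn_phi hs₂ hu₂).comp (hlin (1 - α)) hd₂)).sub analyticOn_const
  · intro z hz0 hz
    obtain ⟨hm₁, hm₂, hg⟩ := phi_freeStep hα (show z ∈ domain (freeStep μ₁ μ₂ α) from ⟨hz0, hz⟩)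
    refine ⟨?_, hg⟩
    have hnn := zGreen_nonneg (tsum_freeStep hα) (show z ∈ domain (freeStep μ₁ μ₂ α) from ⟨hz0, hz⟩)
    refine (ENNReal.ofReal_lt_iff_lt_toReal hnn hfin.ne).mp (lt_min ?_ ?_)
    · rw [ENNReal.lt_div_iff_mul_lt (Or.inl (ENNReal.ofReal_pos.mpr hα.1).ne')
        (Or.inl ENNReal.ofReal_ne_top), mul_comm, ← ENNReal.ofReal_mul hα.1.le]
      exact hm₁.2
    · rw [ENNReal.lt_div_iff_mul_lt (Or.inl (ENNReal.ofReal_pos.mpr hα').ne')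
        (Or.inl ENNReal.ofReal_ne_top), mul_comm, ← ENNReal.ofReal_mul hα'.le]
      exact hm₂.2
  · have h := ((tendsto_psi_mul hu₁ hα.1 hTpos hc₁).add (tendsto_psi_mul hu₂ hα' hTpos hc₂)).sub_const 1
    refine h.congr' ?_
    filter_upwards [Ioo_mem_nhdsLT hTpos] with t ht
    have ht' : t ∈ Ico 0 T := ⟨ht.1.le, ht.2⟩
    have hD := (((hasDerivAt_phi_mul hu₁ hα.1 ht.1 (hd₁ t ht')).add
      (hasDerivAt_phi_mul hu₂ hα' ht.1 (hd₂ t ht'))).sub_const 1).deriv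
    rw [psi_eq_phiIntercept (hd₁ t ht'), psi_eq_phiIntercept (hd₂ t ht'), phiIntercept,
      phiIntercept]
    have hD' : deriv (fun t => phi μ₁ (α * t) + phi μ₂ ((1 - α) * t) - 1) t =
      deriv (phi μ₁) (α * t) * α + deriv (phi μ₂) ((1 - α) * t) * (1 - α) := hD
    rw [hD']
    ring

end Upsilon

end FreeProductWalk

end

theorem lemma7p1 {Γ₁ Γ₂ : Type*} [Group Γ₁] [Group Γ₂] [Group.FG Γ₁] [Group.FG Γ₂]
    [Nontrivial Γ₁] [Nontrivial Γ₂] (μ₁ : PMF Γ₁) (μ₂ : PMF Γ₂)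
    (h₁ : FreeProductWalk.IsIrreducibleWalk μ₁) (h₂ : FreeProductWalk.IsIrreducibleWalk μ₂)
    (hθ : ∀ α ∈ Ioo (0 : ℝ) 1, FreeProductWalk.thetaBar μ₁ μ₂ α < ∞) :
    ContinuousOn (FreeProductWalk.upsilon μ₁ μ₂) (Ioo 0 1) ∧
    StrictAntiOn (FreeProductWalk.upsilon μ₁ μ₂)
      (Ioo 0 1 ∩ Ioc 0 (FreeProductWalk.alphaCrit μ₁ μ₂)) ∧
    StrictMonoOn (FreeProductWalk.upsilon μ₁ μ₂)
      (Ioo 0 1 ∩ Ico (FreeProductWalk.alphaCrit μ₁ μ₂) 1) ∧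
    ∀ α ∈ Ioo (0 : ℝ) 1,
      FreeProductWalk.IsPsiThetaBar μ₁ μ₂ α (FreeProductWalk.upsilon μ₁ μ₂ α) := by
  have hu₁ := h₁.exists_taboo_ne_zero (PMF.tsum_coe μ₁).le
  have hu₂ := h₂.exists_taboo_ne_zero (PMF.tsum_coe μ₂).le
  exact ⟨FreeProductWalk.continuousOn_upsilon hu₁ hu₂ hθ,
    FreeProductWalk.strictAntiOn_upsilon hu₁ hθ, FreeProductWalk.strictMonoOn_upsilon hu₂ hθ,
    fun α hα => FreeProductWalk.isPsiThetaBar_upsilon hu₁ hu₂ hα (hθ α hα)⟩
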